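/- Let $\mathcal L=\mathcal L(\mathcal F,\mathcal G)$ be an LE-signature: disjoint sets $\mathcal F,\mathcal G$ of connectives, each $h$ with an arity $n_h\in\mathbb N$ and an order-type $\varepsilon_h\in\{1,\partial\}^{n_h}$. Let $\mathcal F^*,\mathcal G^*$ be obtained by adding, for each coordinate $i$, the residual $f_i^\sharp$ of $f\in\mathcal F$ (to $\mathcal G^*$ if $\varepsilon_f(i)=1$, to $\mathcal F^*$ if $\varepsilon_f(i)=\partial$) and the residual $g_i^\flat$ of $g\in\mathcal G$ (to $\mathcal F^*$ if $\varepsilon_g(i)=1$, to $\mathcal G^*$ if $\varepsilon_g(i)=\partial$), with the order-type that keeps the value at $i$ and, at the other coordinates, reverses the values if the value at $i$ is $1$ and keeps them if it is $\partial$. Formulas are built from atoms by $\bot,\top,\wedge,\vee$, $\mathcal F$, $\mathcal G$; the structures $\mathsf{Str}_{\mathcal F}\ni x::=\varphi\mid \mathsf F_f(\overline x)$ $(f\in\mathcal F^*)$ and $\mathsf{Str}_{\mathcal G}\ni y::=\varphi\mid\mathsf G_g(\overline y)$ $(g\in\mathcal G^*)$ are defined simultaneously, where arguments at coordinates with order-type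 $\partial$ come from the other sort. The display calculus $\mathrm{D.LE}$ derives sequents $x\Rightarrow y$ ($x\in\mathsf{Str}_{\mathcal F}$, $y\in\mathsf{Str}_{\mathcal G}$) by identity $p\Rightarrow p$, cut on formulas, the invertible display rules that express that $f_i^\sharp$, $g_i^\flat$ are residuals of $f\in\mathcal F$, $g\in\mathcal G$, the axioms $\bot\Rightarrow y$, $x\Rightarrow\top$, the left and right rules for $\wedge,\vee$, and the left and right introduction rules for each $f\in\mathcal F$, $g\in\mathcal G$; $\mathrm{cfD.LE}$ is $\mathrm{D.LE}$ without cut. A structural rule has finitely many premises $S_j\Rightarrow T_j$ and a conclusion $S_0\Rightarrow T_0$ built by structural connectives from metavariables of two sorts, ranging over $\mathsf{Str}_{\mathcal F}$ and $\mathsf{Str}_{\mathcal G}$ respectively. It is analytic if every metavariable of a premise occurs in the conclusion and no metavariable occurs more than once in the conclusion (the remaining conditions among C$_1$–C$_7$ of proper display calculi hold for every such schema). $\mathrm{D.LE'}$, $\mathrm{cfD.LE'}$ denote extensions of $\mathrm{D.LE}$, $\mathrm{cfD.LE}$ by an arbitrary set of analytic structural rules. Let $\mathrm D$ be one of $\mathrm{D.LE},\mathrm{cfD.LE},\mathrm{D.LE'},\mathrm{cfD.LE'}$.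 A functional $\mathrm D$-frame $\mathbb F_{\mathrm D}$ consists of $W=\mathsf{Str}_{\mathcal F}$, $U=\mathsf{Str}_{\mathcal G}$, a relation $N\subseteq W\times U$ closed under all instances of the rules of $\mathrm D$, and the relations $R_f(y,\overline x)\iff \mathsf F_f(\overline x)\,N\,y$, $R_g(x,\overline y)\iff x\,N\,\mathsf G_g(\overline y)$ for $f\in\mathcal F$, $g\in\mathcal G$. Write $(\cdot)^\uparrow,(\cdot)^\downarrow$ for the polar maps of $N$, and $R^{(0)}[\overline C]$ for the set of points that are $R$-related to all tuples in $\overline C$. The complex algebra $\mathbb F_{\mathrm D}^+$ is the complete lattice of the sets $X\subseteq W$ with $X^{\uparrow\downarrow}=X$, with the operations $f(\overline X)=(R_f^{(0)}[\overline{X^{\varepsilon_f}}])^\downarrow$ and $g(\overline X)=R_g^{(0)}[\overline{X^{\varepsilon_g}}]$, where $X_i^{\varepsilon_f(i)}$ is $X_i$ if $\varepsilon_f(i)=1$ and $X_i^\uparrow$ if $\varepsilon_f(i)=\partial$, and $X_i^{\varepsilon_g(i)}$ is $X_i^\uparrow$ if $\varepsilon_g(i)=1$ and $X_i$ if $\varepsilon_g(i)=\partial$.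 An $\mathcal L$-algebra on a complete lattice is *complete* if, in each coordinate, each $f$ turns arbitrary joins (if $\varepsilon_f(i)=1$) or meets (if $\varepsilon_f(i)=\partial$) into joins, and each $g$ turns arbitrary meets (if $\varepsilon_g(i)=1$) or joins (if $\varepsilon_g(i)=\partial$) into meets. Structural connectives are interpreted in it as the corresponding operations and residuals, and $\Rightarrow$ as $\le$. A set $Ax$ of inequalities between formulas (for instance analytic inductive ones) *corresponds* to a set of structural rules if a complete $\mathcal L$-algebra validates $Ax$ exactly when all the rules are sound in it. **Theorem.** Every functional $\mathrm D$-frame $\mathbb F_{\mathrm D}$ is an $\mathcal L$-frame (all sets $R_f^{(0)}[\overline x]$, $R_f^{(i)}[y,\overline x^{\,i}]$, $R_g^{(0)}[\overline y]$, $R_g^{(i)}[x,\overline y^{\,i}]$ are Galois-stable), and: 1. every rule of $\mathrm D$ is sound in $\mathbb F_{\mathrm D}^+$: every valuation of the atoms in $\mathbb F_{\mathrm D}^+$ that satisfies the premises of a rule instance satisfies its conclusion; moreover, for each added analytic structural rule, every assignment of elements of $\mathbb F_{\mathrm D}^+$ to the metavariables that satisfies the premises satisfies the conclusion; 2. $\mathbb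 F_{\mathrm D}^+$ is a normal and complete $\mathcal L$-algebra, and hence, with the residuals of its operations, a complete $\mathcal L^*$-algebra; 3. if $\mathrm D\in\{\mathrm{D.LE'},\mathrm{cfD.LE'}\}$, then $\mathbb F_{\mathrm D}^+$ validates every sequent $\varphi\Rightarrow\psi$ between formulas that is derivable in $\mathrm{D.LE'}$ (with cut), and, for every set $Ax$ of inequalities that corresponds to the added rules, it validates every sequent of the axiomatic extension $\mathbb L_{\mathrm{LE}}+Ax$ of the minimal $\mathcal L$-logic, in particular $Ax$ itself. -/

import Mathlib

universe u

namespace LEDisplay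

/-! ### Signatures -/

/-- The two values `1` and `∂` of an order-type. The same two values also serve as the two sorts
of the calculus: `one` is the sort of `Str_F` (and of `W`), `dual` that of `Str_G` (and of `U`). -/
inductive OT : Type
  | one
  | dual
  deriving DecidableEq

/-- The opposite value. -/
def OT.op : OT → OT
  | .one => .dual
  | .dual => .one

theorem OT.op_op (s : OT) : s.op.op = s := by cases s <;> rfl

/-- An LE-signature: disjoint families `F`, `G` of connectives of finite arity with order-types. -/
structure Sig : Type (u + 1) where
  F : Type u
  G : Type u
  arF : F → ℕ
  arG : G → ℕ
  epsF : (f : F) → Fin (arF f) → OT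
  epsG : (g : G) → Fin (arG g) → OT

/-- The connectives of `F*`: those of `F`, the `f♯ᵢ` with `ε_f(i) = ∂`, the `g♭ᵢ` with
`ε_g(i) = 1`. -/
inductive FStar (S : Sig.{u}) : Type u
  | base (f : S.F)
  | sharp (f : S.F) (i : Fin (S.arF f)) (h : S.epsF f i = OT.dual)
  | flat (g : S.G) (i : Fin (S.arG g)) (h : S.epsG g i = OT.one)

/-- The connectives of `G*`: those of `G`, the `f♯ᵢ` with `ε_f(i) = 1`, the `g♭ᵢ` with
`ε_g(i) = ∂`. -/
inductive GStar (S : Sig.{u}) : Type u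
  | base (g : S.G)
  | sharp (f : S.F) (i : Fin (S.arF f)) (h : S.epsF f i = OT.one)
  | flat (g : S.G) (i : Fin (S.arG g)) (h : S.epsG g i = OT.dual)

/-- The order-type of the residual in coordinate `i` of a connective with order-type `ε`:
coordinate `i` keeps its value; the others are reversed if `ε i = 1` and kept if `ε i = ∂`. -/
def resEps {n : ℕ} (ε : Fin n → OT) (i j : Fin n) : OT :=
  if j = i then ε i else if ε i = OT.one then (ε j).op else ε j

/-- The signature of the tense language `L*`. -/
@[reducible] def Sig.star (S : Sig.{u}) : Sig.{u} where
  F := FStar S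
  G := GStar S
  arF
    | .base f => S.arF f
    | .sharp f _ _ => S.arF f
    | .flat g _ _ => S.arG g
  arG
    | .base g => S.arG g
    | .sharp f _ _ => S.arF f
    | .flat g _ _ => S.arG g
  epsF
    | .base f => S.epsF f
    | .sharp f i _ => resEps (S.epsF f) i
    | .flat g i _ => resEps (S.epsG g) i
  epsG
    | .base g => S.epsG g
    | .sharp f i _ => resEps (S.epsF f) i
    | .flat g i _ => resEps (S.epsG g) i

theorem resEps_self {n : ℕ} (ε : Fin n → OT) (i : Fin n) : resEps ε i i = ε i := by
  simp [resEps]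

theorem resEps_of_one {n : ℕ} {ε : Fin n → OT} {i j : Fin n} (h : ε i = OT.one) (hj : j ≠ i) :
    resEps ε i j = (ε j).op := by
  simp [resEps, h, hj]

theorem resEps_of_dual {n : ℕ} {ε : Fin n → OT} {i j : Fin n} (h : ε i = OT.dual) (hj : j ≠ i) :
    resEps ε i j = ε j := by
  simp [resEps, h, hj]

/-! ### Formulas, structures, sequents -/

/-- Formulas. -/
inductive Fm (S : Sig.{u}) (Atom : Type u) : Type u
  | atom (p : Atom)
  | bot
  | top
  | and (φ ψ : Fm S Atom)
  | or (φ ψ : Fm S Atom)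
  | f (f : S.F) (φ : Fin (S.arF f) → Fm S Atom)
  | g (g : S.G) (φ : Fin (S.arG g) → Fm S Atom)

/-- Structures: `Str S Atom .one` is `Str_F` and `Str S Atom .dual` is `Str_G`. There is one
structural connective for each element of `F*` and `G*`. -/
inductive Str (S : Sig.{u}) (Atom : Type u) : OT → Type u
  | fm {s : OT} (φ : Fm S Atom) : Str S Atom s
  | F (f : S.star.F) (x : (i : Fin (S.star.arF f)) → Str S Atom (S.star.epsF f i)) :
      Str S Atom OT.one
  | G (g : S.star.G) (y : (i : Fin (S.star.arG g)) → Str S Atom (S.star.epsG g i).op) :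
      Str S Atom OT.dual

/-- Sequents `x ⇒ y` with `x ∈ Str_F`, `y ∈ Str_G`. -/
structure Sqt (S : Sig.{u}) (Atom : Type u) : Type u where
  ant : Str S Atom OT.one
  suc : Str S Atom OT.dual

/-- The sequent `x ⇒ φ` if `x ∈ Str_F`, and `φ ⇒ x` if `x ∈ Str_G`. -/
def Sqt.towards {S : Sig.{u}} {Atom : Type u} : (s : OT) → Str S Atom s → Fm S Atom → Sqt S Atom
  | .one, x, φ => ⟨x, .fm φ⟩
  | .dual, y, φ => ⟨.fm φ, y⟩

/-- The tuple `x̄ⁱ_y`, obtained from `x̄` by putting `y` in coordinate `i`. The coordinates of the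
tuple have sorts, and the sorts `t` of the result are only propositionally equal to the given
ones. -/
def replaceAt {P : OT → Type u} {n : ℕ} {s t : Fin n → OT} {r : OT} (i : Fin n)
    (hi : r = t i) (hne : ∀ j, j ≠ i → s j = t j) (x : (j : Fin n) → P (s j)) (y : P r) :
    (j : Fin n) → P (t j) :=
  fun j => if hj : j = i then cast (congrArg P (hi.trans (congrArg t hj.symm))) y
    else cast (congrArg P (hne j hj)) (x j)

/-! ### The calculus -/

/-- The display rules: `Display a b` says that `a` and `b` are the upper and the lower sequent of
an instance of one of the four (invertible) display rules. -/
inductive Display {S : Sig.{u}} {Atom : Type u} : Sqt S Atom → Sqt S Atom → Prop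
  | f_one (f : S.F) (i : Fin (S.arF f)) (h : S.epsF f i = OT.one)
      (x : (j : Fin (S.arF f)) → Str S Atom (S.epsF f j)) (y : Str S Atom OT.dual) :
      Display ⟨.F (.base f) x, y⟩
        ⟨cast (congrArg (Str S Atom) h) (x i),
          .G (.sharp f i h) (replaceAt (t := fun j => (resEps (S.epsF f) i j).op) i
            (by simp only [resEps_self, h]; rfl)
            (fun j hj => by simp only [resEps_of_one h hj, OT.op_op]) x y)⟩
  | f_dual (f : S.F) (i : Fin (S.arF f)) (h : S.epsF f i = OT.dual)
      (x : (j : Fin (S.arF f)) → Str S Atom (S.epsF f j)) (y : Str S Atom OT.dual) :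
      Display ⟨.F (.base f) x, y⟩
        ⟨.F (.sharp f i h) (replaceAt (t := fun j => resEps (S.epsF f) i j) i
            (by simp only [resEps_self, h])
            (fun j hj => by simp only [resEps_of_dual h hj]) x y),
          cast (congrArg (Str S Atom) h) (x i)⟩
  | g_one (g : S.G) (i : Fin (S.arG g)) (h : S.epsG g i = OT.one)
      (y : (j : Fin (S.arG g)) → Str S Atom (S.epsG g j).op) (x : Str S Atom OT.one) :
      Display ⟨x, .G (.base g) y⟩
        ⟨.F (.flat g i h) (replaceAt (s := fun j => (S.epsG g j).op)
            (t := fun j => resEps (S.epsG g) i j) i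
            (by simp only [resEps_self, h])
            (fun j hj => by simp only [resEps_of_one h hj]) y x),
          cast (congrArg (fun s => Str S Atom s.op) h) (y i)⟩
  | g_dual (g : S.G) (i : Fin (S.arG g)) (h : S.epsG g i = OT.dual)
      (y : (j : Fin (S.arG g)) → Str S Atom (S.epsG g j).op) (x : Str S Atom OT.one) :
      Display ⟨x, .G (.base g) y⟩
        ⟨cast (congrArg (fun s => Str S Atom s.op) h) (y i),
          .G (.flat g i h) (replaceAt (s := fun j => (S.epsG g j).op)
            (t := fun j => (resEps (S.epsG g) i j).op) i
            (by simp only [resEps_self, h]; rfl)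
            (fun j hj => by simp only [resEps_of_dual h hj]) y x)⟩

/-- The instances (list of premises, conclusion) of the rules of `cfD.LE`. -/
inductive BasicRule {S : Sig.{u}} {Atom : Type u} : List (Sqt S Atom) → Sqt S Atom → Prop
  | id (p : Atom) : BasicRule [] ⟨.fm (.atom p), .fm (.atom p)⟩
  | display {a b : Sqt S Atom} (h : Display a b) : BasicRule [a] b
  | displayInv {a b : Sqt S Atom} (h : Display a b) : BasicRule [b] a
  | bot (y : Str S Atom OT.dual) : BasicRule [] ⟨.fm .bot, y⟩
  | top (x : Str S Atom OT.one) : BasicRule [] ⟨x, .fm .top⟩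
  | andL₁ (φ ψ : Fm S Atom) (y : Str S Atom OT.dual) :
      BasicRule [⟨.fm φ, y⟩] ⟨.fm (.and φ ψ), y⟩
  | andL₂ (φ ψ : Fm S Atom) (y : Str S Atom OT.dual) :
      BasicRule [⟨.fm ψ, y⟩] ⟨.fm (.and φ ψ), y⟩
  | orR₁ (φ ψ : Fm S Atom) (x : Str S Atom OT.one) :
      BasicRule [⟨x, .fm φ⟩] ⟨x, .fm (.or φ ψ)⟩
  | orR₂ (φ ψ : Fm S Atom) (x : Str S Atom OT.one) :
      BasicRule [⟨x, .fm ψ⟩] ⟨x, .fm (.or φ ψ)⟩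
  | andR (φ ψ : Fm S Atom) (x : Str S Atom OT.one) :
      BasicRule [⟨x, .fm φ⟩, ⟨x, .fm ψ⟩] ⟨x, .fm (.and φ ψ)⟩
  | orL (φ ψ : Fm S Atom) (y : Str S Atom OT.dual) :
      BasicRule [⟨.fm φ, y⟩, ⟨.fm ψ, y⟩] ⟨.fm (.or φ ψ), y⟩
  | fL (f : S.F) (φ : Fin (S.arF f) → Fm S Atom) (y : Str S Atom OT.dual) :
      BasicRule [⟨.F (.base f) (fun i => .fm (φ i)), y⟩] ⟨.fm (.f f φ), y⟩
  | fR (f : S.F) (φ : Fin (S.arF f) → Fm S Atom)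
      (x : (i : Fin (S.arF f)) → Str S Atom (S.epsF f i)) :
      BasicRule (List.ofFn fun i => Sqt.towards (S.epsF f i) (x i) (φ i))
        ⟨.F (.base f) x, .fm (.f f φ)⟩
  | gL (g : S.G) (ψ : Fin (S.arG g) → Fm S Atom) (x : Str S Atom OT.one) :
      BasicRule [⟨x, .G (.base g) (fun i => .fm (ψ i))⟩] ⟨x, .fm (.g g ψ)⟩
  | gR (g : S.G) (ψ : Fin (S.arG g) → Fm S Atom)
      (y : (i : Fin (S.arG g)) → Str S Atom (S.epsG g i).op) :
      BasicRule (List.ofFn fun i => Sqt.towards (S.epsG g i).op (y i) (ψ i))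
        ⟨.fm (.g g ψ), .G (.base g) y⟩

/-- The instances of the cut rule. -/
inductive CutRule {S : Sig.{u}} {Atom : Type u} : List (Sqt S Atom) → Sqt S Atom → Prop
  | cut (x : Str S Atom OT.one) (φ : Fm S Atom) (y : Str S Atom OT.dual) :
      CutRule [⟨x, .fm φ⟩, ⟨.fm φ, y⟩] ⟨x, y⟩

/-! ### Structural rules -/

/-- Metastructures over denumerably many metavariables of each of the two sorts. A metavariable of
sort `one` ranges over `Str_F`, one of sort `dual` over `Str_G`. -/
inductive MStr (S : Sig.{u}) : OT → Type u
  | var {s : OT} (k : ℕ) : MStr S s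
  | F (f : S.star.F) (x : (i : Fin (S.star.arF f)) → MStr S (S.star.epsF f i)) : MStr S OT.one
  | G (g : S.star.G) (y : (i : Fin (S.star.arG g)) → MStr S (S.star.epsG g i).op) :
      MStr S OT.dual

/-- The number of occurrences in a metastructure of the `k`-th metavariable of sort `r`. -/
def MStr.count {S : Sig.{u}} (r : OT) (k : ℕ) : {s : OT} → MStr S s → ℕ
  | s, .var m => if s = r ∧ m = k then 1 else 0
  | _, .F _ x => ∑ i, (x i).count r k
  | _, .G _ y => ∑ i, (y i).count r k

/-- The instance of a metastructure under an assignment of structures to metavariables. -/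
def MStr.inst {S : Sig.{u}} {Atom : Type u} (η : (s : OT) → ℕ → Str S Atom s) :
    {s : OT} → MStr S s → Str S Atom s
  | s, .var k => η s k
  | _, .F f x => .F f (fun i => (x i).inst η)
  | _, .G g y => .G g (fun i => (y i).inst η)

/-- Metasequents `S ⇒ T`. -/
structure MSqt (S : Sig.{u}) : Type u where
  ant : MStr S OT.one
  suc : MStr S OT.dual

/-- The number of occurrences of a metavariable in a metasequent. -/
def MSqt.count {S : Sig.{u}} (r : OT) (k : ℕ) (a : MSqt S) : ℕ :=
  a.ant.count r k + a.suc.count r k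

/-- The instance of a metasequent. -/
def MSqt.inst {S : Sig.{u}} {Atom : Type u} (η : (s : OT) → ℕ → Str S Atom s) (a : MSqt S) :
    Sqt S Atom :=
  ⟨a.ant.inst η, a.suc.inst η⟩

/-- A (schematic) structural rule: finitely many premises and a conclusion, all of them
metasequents. -/
structure StructRule (S : Sig.{u}) : Type u where
  prems : List (MSqt S)
  concl : MSqt S

/-- Analytic structural rules. The parameters of a rule instance are the structures substituted
for the metavariables, and two of them are congruent iff they are substituted for the same
metavariable. The conditions C1 (preservation of formulas: every metavariable of a premise occurs
in the conclusion) and C3 (non-proliferation: no metavariable occurs twice in the conclusion) are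
the two fields. The other conditions among C1-C7 hold for every `StructRule`: congruent parameters
are equal (C2); a metavariable of sort `one` only occurs in precedent position, and one of sort
`dual` only in succedent position, because metastructures are sorted (C4); there are no principal
formulas (C5); and the instances are closed under substitution of arbitrary structures for
congruent parameters (C6, C7). -/
structure StructRule.IsAnalytic {S : Sig.{u}} (R : StructRule S) : Prop where
  c1 : ∀ a ∈ R.prems, ∀ r k, a.count r k ≠ 0 → R.concl.count r k ≠ 0
  c3 : ∀ r k, R.concl.count r k ≤ 1

/-- One of the calculi `D.LE`, `cfD.LE` (no additional rules), `D.LE'`, `cfD.LE'` (with a set of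
additional analytic structural rules), with or without the cut rule. -/
structure Calculus (S : Sig.{u}) : Type u where
  hasCut : Prop
  extra : Set (StructRule S)
  analytic : ∀ R ∈ extra, R.IsAnalytic

/-- The instances of the rules of a calculus. -/
def Calculus.IsRule {S : Sig.{u}} (D : Calculus S) {Atom : Type u} (prems : List (Sqt S Atom))
    (concl : Sqt S Atom) : Prop :=
  BasicRule prems concl ∨ (D.hasCut ∧ CutRule prems concl) ∨
    ∃ R ∈ D.extra, ∃ η : (s : OT) → ℕ → Str S Atom s,
      prems = R.prems.map (MSqt.inst η) ∧ concl = R.concl.inst η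

/-- The same calculus with the cut rule. -/
def Calculus.withCut {S : Sig.{u}} (D : Calculus S) : Calculus S :=
  { D with hasCut := True }

/-- Derivability in a calculus. -/
inductive Calculus.Derivable {S : Sig.{u}} (D : Calculus S) {Atom : Type u} : Sqt S Atom → Prop
  | step (prems : List (Sqt S Atom)) (concl : Sqt S Atom) (h : D.IsRule prems concl)
      (ih : ∀ a ∈ prems, D.Derivable a) : D.Derivable concl

/-! ### Algebras -/

/-- The operations of an `L`-algebra on `A`. -/
structure LEAlg (S : Sig.{u}) (A : Type u) : Type u where
  fOp : (f : S.F) → (Fin (S.arF f) → A) → A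
  gOp : (g : S.G) → (Fin (S.arG g) → A) → A

namespace LEAlg

variable {S : Sig.{u}} {A : Type u} [CompleteLattice A]

/-- Normality: each `f` preserves finite joins in the coordinates with `ε_f(i) = 1` and reverses
finite meets in those with `ε_f(i) = ∂`; dually for each `g`. -/
structure IsNormal (𝔸 : LEAlg S A) : Prop where
  f_one : ∀ f i, S.epsF f i = OT.one → ∀ a : Fin (S.arF f) → A,
    (∀ b c, 𝔸.fOp f (Function.update a i (b ⊔ c)) =
      𝔸.fOp f (Function.update a i b) ⊔ 𝔸.fOp f (Function.update a i c)) ∧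
    𝔸.fOp f (Function.update a i ⊥) = ⊥
  f_dual : ∀ f i, S.epsF f i = OT.dual → ∀ a : Fin (S.arF f) → A,
    (∀ b c, 𝔸.fOp f (Function.update a i (b ⊓ c)) =
      𝔸.fOp f (Function.update a i b) ⊔ 𝔸.fOp f (Function.update a i c)) ∧
    𝔸.fOp f (Function.update a i ⊤) = ⊥
  g_one : ∀ g i, S.epsG g i = OT.one → ∀ a : Fin (S.arG g) → A,
    (∀ b c, 𝔸.gOp g (Function.update a i (b ⊓ c)) =
      𝔸.gOp g (Function.update a i b) ⊓ 𝔸.gOp g (Function.update a i c)) ∧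
    𝔸.gOp g (Function.update a i ⊤) = ⊤
  g_dual : ∀ g i, S.epsG g i = OT.dual → ∀ a : Fin (S.arG g) → A,
    (∀ b c, 𝔸.gOp g (Function.update a i (b ⊔ c)) =
      𝔸.gOp g (Function.update a i b) ⊓ 𝔸.gOp g (Function.update a i c)) ∧
    𝔸.gOp g (Function.update a i ⊥) = ⊤

/-- Complete `L`-algebras: the lattice is complete, every `f` is a complete `ε_f`-operator and
every `g` is a complete `ε_g`-dual operator. -/
structure IsComplete (𝔸 : LEAlg S A) : Prop where
  f_one : ∀ f i, S.epsF f i = OT.one → ∀ (a : Fin (S.arF f) → A) (C : Set A),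
    𝔸.fOp f (Function.update a i (sSup C)) = ⨆ c ∈ C, 𝔸.fOp f (Function.update a i c)
  f_dual : ∀ f i, S.epsF f i = OT.dual → ∀ (a : Fin (S.arF f) → A) (C : Set A),
    𝔸.fOp f (Function.update a i (sInf C)) = ⨆ c ∈ C, 𝔸.fOp f (Function.update a i c)
  g_one : ∀ g i, S.epsG g i = OT.one → ∀ (a : Fin (S.arG g) → A) (C : Set A),
    𝔸.gOp g (Function.update a i (sInf C)) = ⨅ c ∈ C, 𝔸.gOp g (Function.update a i c)
  g_dual : ∀ g i, S.epsG g i = OT.dual → ∀ (a : Fin (S.arG g) → A) (C : Set A),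
    𝔸.gOp g (Function.update a i (sSup C)) = ⨅ c ∈ C, 𝔸.gOp g (Function.update a i c)

/-- `𝔹` is an `L*`-algebra: the operations `f♯ᵢ`, `g♭ᵢ` are the residuals (or Galois adjoints)
of `f`, `g` in coordinate `i`. -/
structure IsTense (𝔹 : LEAlg S.star A) : Prop where
  f_one : ∀ f i (h : S.epsF f i = OT.one) (a : Fin (S.arF f) → A) (b : A),
    𝔹.fOp (.base f) a ≤ b ↔ a i ≤ 𝔹.gOp (.sharp f i h) (Function.update a i b)
  f_dual : ∀ f i (h : S.epsF f i = OT.dual) (a : Fin (S.arF f) → A) (b : A),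
    𝔹.fOp (.base f) a ≤ b ↔ 𝔹.fOp (.sharp f i h) (Function.update a i b) ≤ a i
  g_one : ∀ g i (h : S.epsG g i = OT.one) (a : Fin (S.arG g) → A) (b : A),
    b ≤ 𝔹.gOp (.base g) a ↔ 𝔹.fOp (.flat g i h) (Function.update a i b) ≤ a i
  g_dual : ∀ g i (h : S.epsG g i = OT.dual) (a : Fin (S.arG g) → A) (b : A),
    b ≤ 𝔹.gOp (.base g) a ↔ a i ≤ 𝔹.gOp (.flat g i h) (Function.update a i b)

/-- The expansion of an algebra on a complete lattice to the language `L*`. In a complete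
`L`-algebra these are the only operations which make it an `L*`-algebra. -/
def tense (𝔸 : LEAlg S A) : LEAlg S.star A where
  fOp
    | .base f => 𝔸.fOp f
    | .sharp f i _ => fun a => sInf {c | 𝔸.fOp f (Function.update a i c) ≤ a i}
    | .flat g i _ => fun a => sInf {c | a i ≤ 𝔸.gOp g (Function.update a i c)}
  gOp
    | .base g => 𝔸.gOp g
    | .sharp f i _ => fun a => sSup {c | 𝔸.fOp f (Function.update a i c) ≤ a i}
    | .flat g i _ => fun a => sSup {c | a i ≤ 𝔸.gOp g (Function.update a i c)}

variable {Atom : Type u}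

/-- The value of a formula. -/
def evalFm (𝔸 : LEAlg S A) (V : Atom → A) : Fm S Atom → A
  | .atom p => V p
  | .bot => ⊥
  | .top => ⊤
  | .and φ ψ => 𝔸.evalFm V φ ⊓ 𝔸.evalFm V ψ
  | .or φ ψ => 𝔸.evalFm V φ ⊔ 𝔸.evalFm V ψ
  | .f f φ => 𝔸.fOp f (fun i => 𝔸.evalFm V (φ i))
  | .g g φ => 𝔸.gOp g (fun i => 𝔸.evalFm V (φ i))

/-- The value of a structure: structural connectives are read as connectives of `L*`. -/
def evalStr (𝔸 : LEAlg S A) (V : Atom → A) : {s : OT} → Str S Atom s → A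
  | _, .fm φ => 𝔸.evalFm V φ
  | _, .F f x => 𝔸.tense.fOp f (fun i => 𝔸.evalStr V (x i))
  | _, .G g y => 𝔸.tense.gOp g (fun i => 𝔸.evalStr V (y i))

/-- The value of a metastructure under an assignment of elements to metavariables. -/
def evalMStr (𝔸 : LEAlg S A) (h : OT → ℕ → A) : {s : OT} → MStr S s → A
  | s, .var k => h s k
  | _, .F f x => 𝔸.tense.fOp f (fun i => 𝔸.evalMStr h (x i))
  | _, .G g y => 𝔸.tense.gOp g (fun i => 𝔸.evalMStr h (y i))

/-- The sequent `x ⇒ y` is satisfied under the valuation `V`. -/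
def Sat (𝔸 : LEAlg S A) (V : Atom → A) (a : Sqt S Atom) : Prop :=
  𝔸.evalStr V a.ant ≤ 𝔸.evalStr V a.suc

/-- A rule instance is sound: every valuation satisfying the premises satisfies the conclusion. -/
def SoundInstance (𝔸 : LEAlg S A) (prems : List (Sqt S Atom)) (concl : Sqt S Atom) : Prop :=
  ∀ V : Atom → A, (∀ a ∈ prems, 𝔸.Sat V a) → 𝔸.Sat V concl

/-- A schematic structural rule is sound: for every assignment `h` of elements of the algebra to
the metavariables, if `h(Sᵢ) ≤ h(Tᵢ)` for all premises `Sᵢ ⇒ Tᵢ` then `h(S₀) ≤ h(T₀)` for the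
conclusion `S₀ ⇒ T₀`. -/
def SoundRule (𝔸 : LEAlg S A) (R : StructRule S) : Prop :=
  ∀ h : OT → ℕ → A, (∀ a ∈ R.prems, 𝔸.evalMStr h a.ant ≤ 𝔸.evalMStr h a.suc) →
    𝔸.evalMStr h R.concl.ant ≤ 𝔸.evalMStr h R.concl.suc

/-- The algebra validates `φ ⊢ ψ`. -/
def Valid (𝔸 : LEAlg S A) (φ ψ : Fm S Atom) : Prop :=
  ∀ V : Atom → A, 𝔸.evalFm V φ ≤ 𝔸.evalFm V ψ

end LEAlg

/-! ### LE-logics -/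

/-- Uniform substitution. -/
def Fm.subst {S : Sig.{u}} {Atom : Type u} (σ : Atom → Fm S Atom) : Fm S Atom → Fm S Atom
  | .atom p => σ p
  | .bot => .bot
  | .top => .top
  | .and φ ψ => .and (φ.subst σ) (ψ.subst σ)
  | .or φ ψ => .or (φ.subst σ) (ψ.subst σ)
  | .f k φ => .f k (fun i => (φ i).subst σ)
  | .g k φ => .g k (fun i => (φ i).subst σ)

/-- The axiomatic extension of the minimal `L`-logic by the set `Ax` of sequents `φ ⊢ ψ`. -/
inductive Logic {S : Sig.{u}} {Atom : Type u} (Ax : Set (Fm S Atom × Fm S Atom)) :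
    Fm S Atom → Fm S Atom → Prop
  | ax {φ ψ} (h : (φ, ψ) ∈ Ax) : Logic Ax φ ψ
  | refl (φ) : Logic Ax φ φ
  | bot (φ) : Logic Ax .bot φ
  | top (φ) : Logic Ax φ .top
  | or₁ (φ ψ) : Logic Ax φ (.or φ ψ)
  | or₂ (φ ψ) : Logic Ax ψ (.or φ ψ)
  | and₁ (φ ψ) : Logic Ax (.and φ ψ) φ
  | and₂ (φ ψ) : Logic Ax (.and φ ψ) ψ
  | f_bot (f i) (h : S.epsF f i = OT.one) (a) : Logic Ax (.f f (Function.update a i .bot)) .bot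
  | f_top (f i) (h : S.epsF f i = OT.dual) (a) : Logic Ax (.f f (Function.update a i .top)) .bot
  | g_top (g i) (h : S.epsG g i = OT.one) (a) : Logic Ax .top (.g g (Function.update a i .top))
  | g_bot (g i) (h : S.epsG g i = OT.dual) (a) : Logic Ax .top (.g g (Function.update a i .bot))
  | f_or (f i) (h : S.epsF f i = OT.one) (a φ ψ) :
      Logic Ax (.f f (Function.update a i (.or φ ψ)))
        (.or (.f f (Function.update a i φ)) (.f f (Function.update a i ψ)))
  | f_and (f i) (h : S.epsF f i = OT.dual) (a φ ψ) :
      Logic Ax (.f f (Function.update a i (.and φ ψ)))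
        (.or (.f f (Function.update a i φ)) (.f f (Function.update a i ψ)))
  | g_and (g i) (h : S.epsG g i = OT.one) (a φ ψ) :
      Logic Ax (.and (.g g (Function.update a i φ)) (.g g (Function.update a i ψ)))
        (.g g (Function.update a i (.and φ ψ)))
  | g_or (g i) (h : S.epsG g i = OT.dual) (a φ ψ) :
      Logic Ax (.and (.g g (Function.update a i φ)) (.g g (Function.update a i ψ)))
        (.g g (Function.update a i (.or φ ψ)))
  | trans {φ χ ψ} (h₁ : Logic Ax φ χ) (h₂ : Logic Ax χ ψ) : Logic Ax φ ψ
  | subst {φ ψ} (σ : Atom → Fm S Atom) (h : Logic Ax φ ψ) : Logic Ax (φ.subst σ) (ψ.subst σ)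
  | and {χ φ ψ} (h₁ : Logic Ax χ φ) (h₂ : Logic Ax χ ψ) : Logic Ax χ (.and φ ψ)
  | or {φ ψ χ} (h₁ : Logic Ax φ χ) (h₂ : Logic Ax ψ χ) : Logic Ax (.or φ ψ) χ
  | f_mono (f i) (h : S.epsF f i = OT.one) (a) {φ ψ} (h₁ : Logic Ax φ ψ) :
      Logic Ax (.f f (Function.update a i φ)) (.f f (Function.update a i ψ))
  | f_anti (f i) (h : S.epsF f i = OT.dual) (a) {φ ψ} (h₁ : Logic Ax φ ψ) :
      Logic Ax (.f f (Function.update a i ψ)) (.f f (Function.update a i φ))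
  | g_mono (g i) (h : S.epsG g i = OT.one) (a) {φ ψ} (h₁ : Logic Ax φ ψ) :
      Logic Ax (.g g (Function.update a i φ)) (.g g (Function.update a i ψ))
  | g_anti (g i) (h : S.epsG g i = OT.dual) (a) {φ ψ} (h₁ : Logic Ax φ ψ) :
      Logic Ax (.g g (Function.update a i ψ)) (.g g (Function.update a i φ))

/-- The set `Ax` of axioms and the set `Rs` of structural rules correspond to each other: a
complete `L`-algebra validates `Ax` iff all rules in `Rs` are sound in it. -/
def Corresponds {S : Sig.{u}} {Atom : Type u} (Rs : Set (StructRule S))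
    (Ax : Set (Fm S Atom × Fm S Atom)) : Prop :=
  ∀ (A : Type u) [CompleteLattice A] (𝔸 : LEAlg S A), 𝔸.IsComplete →
    ((∀ R ∈ Rs, 𝔸.SoundRule R) ↔ ∀ a ∈ Ax, 𝔸.Valid a.1 a.2)

/-! ### Frames -/

/-- The data of an `L`-frame: a polarity `(W, U, N)` with `W = pt .one` and `U = pt .dual`, so that
`W^{ε(i)} = pt (ε i)` and `U^{ε(i)} = pt (ε i).op`, and relations `R_f ⊆ U × W^{ε_f}`,
`R_g ⊆ W × U^{ε_g}`. -/
structure FrameData (S : Sig.{u}) : Type (u + 1) where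
  pt : OT → Type u
  N : pt OT.one → pt OT.dual → Prop
  RF : (f : S.F) → pt OT.dual → ((i : Fin (S.arF f)) → pt (S.epsF f i)) → Prop
  RG : (g : S.G) → pt OT.one → ((i : Fin (S.arG g)) → pt (S.epsG g i).op) → Prop

namespace FrameData

variable {S : Sig.{u}} (𝔽 : FrameData S)

/-- Galois-stable subsets of `W` and of `U`. -/
def IsStable : (s : OT) → Set (𝔽.pt s) → Prop
  | .one, X => lowerPolar 𝔽.N (upperPolar 𝔽.N X) = X
  | .dual, Y => upperPolar 𝔽.N (lowerPolar 𝔽.N Y) = Y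

/-- `R_f⁽⁰⁾[X̄]`. -/
def zeroF (f : S.F) (X : (i : Fin (S.arF f)) → Set (𝔽.pt (S.epsF f i))) : Set (𝔽.pt OT.dual) :=
  {u | ∀ w, (∀ i, w i ∈ X i) → 𝔽.RF f u w}

/-- `R_g⁽⁰⁾[Ȳ]`. -/
def zeroG (g : S.G) (Y : (i : Fin (S.arG g)) → Set (𝔽.pt (S.epsG g i).op)) :
    Set (𝔽.pt OT.one) :=
  {w | ∀ u, (∀ i, u i ∈ Y i) → 𝔽.RG g w u}

/-- `𝔽` is an `L`-frame. -/
structure IsLEFrame : Prop where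
  f_zero : ∀ (f : S.F) (w : (i : Fin (S.arF f)) → 𝔽.pt (S.epsF f i)),
    𝔽.IsStable OT.dual (𝔽.zeroF f (fun i => {w i}))
  f_coord : ∀ (f : S.F) (u₀ : 𝔽.pt OT.dual) (w : (i : Fin (S.arF f)) → 𝔽.pt (S.epsF f i)) i,
    𝔽.IsStable (S.epsF f i) {v | 𝔽.RF f u₀ (Function.update w i v)}
  g_zero : ∀ (g : S.G) (u : (i : Fin (S.arG g)) → 𝔽.pt (S.epsG g i).op),
    𝔽.IsStable OT.one (𝔽.zeroG g (fun i => {u i}))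
  g_coord : ∀ (g : S.G) (w₀ : 𝔽.pt OT.one)
    (u : (i : Fin (S.arG g)) → 𝔽.pt (S.epsG g i).op) i,
    𝔽.IsStable (S.epsG g i).op {v | 𝔽.RG g w₀ (Function.update u i v)}

theorem IsLEFrame.isExtent_zeroG {𝔽 : FrameData S} (h𝔽 : 𝔽.IsLEFrame) (g : S.G)
    (Y : (i : Fin (S.arG g)) → Set (𝔽.pt (S.epsG g i).op)) :
    Order.IsExtent 𝔽.N (𝔽.zeroG g Y) := by
  have key : 𝔽.zeroG g Y =
      ⋂ (u : (i : Fin (S.arG g)) → 𝔽.pt (S.epsG g i).op) (_ : ∀ i, u i ∈ Y i),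
        𝔽.zeroG g (fun i => {u i}) := by
    ext w
    simp only [zeroG, Set.mem_ofPred_eq, Set.mem_iInter, Set.mem_singleton_iff]
    constructor
    · intro h u hu v hv
      obtain rfl : v = u := funext hv
      exact h v hu
    · intro h u hu
      exact h u hu u fun _ => rfl
  rw [key]
  exact Order.IsExtent.iInter₂ _ fun u _ => Order.isExtent_iff.2 (h𝔽.g_zero g u)

/-- The complete lattice `W⁺` of Galois-stable sets, ordered by inclusion of extents. -/
abbrev Stable : Type u := Concept (𝔽.pt OT.one) (𝔽.pt OT.dual) 𝔽.N

/-- For a stable set `X`: the set `X` itself at sort `one` and `X^↑` at sort `dual`. -/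
def side {𝔽 : FrameData S} (X : 𝔽.Stable) : (s : OT) → Set (𝔽.pt s)
  | .one => X.extent
  | .dual => X.intent

/-- The operations of the complex algebra: `f(X̄) = (R_f⁽⁰⁾[X̄^{ε_f}])^↓` and
`g(X̄) = R_g⁽⁰⁾[X̄^{ε_g}]`. -/
def complexAlg (h𝔽 : 𝔽.IsLEFrame) : LEAlg S 𝔽.Stable where
  fOp f X := Concept.ofAttributes 𝔽.N (𝔽.zeroF f fun i => side (X i) (S.epsF f i))
  gOp g X := Concept.ofIsExtent 𝔽.N (𝔽.zeroG g fun i => side (X i) (S.epsG g i).op)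
    (h𝔽.isExtent_zeroG g _)

end FrameData

/-- A functional `D`-frame: it is determined by a relation `N` between `W = Str_F` and `U = Str_G`
which is closed under (all instances of) the rules of `D`. -/
structure FunctionalFrame {S : Sig.{u}} (Atom : Type u) (D : Calculus S) : Type u where
  N : Str S Atom OT.one → Str S Atom OT.dual → Prop
  closed : ∀ (prems : List (Sqt S Atom)) (concl : Sqt S Atom), D.IsRule prems concl →
    (∀ a ∈ prems, N a.ant a.suc) → N concl.ant concl.suc

/-- The frame of a functional `D`-frame: `R_f(y, x̄)` iff `F_f(x̄) N y`, and `R_g(x, ȳ)` iff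
`x N G_g(ȳ)`. -/
def FunctionalFrame.frame {S : Sig.{u}} {Atom : Type u} {D : Calculus S}
    (𝔽 : FunctionalFrame Atom D) : FrameData S where
  pt := Str S Atom
  N := 𝔽.N
  RF f y x := 𝔽.N (.F (.base f) x) y
  RG g x y := 𝔽.N x (.G (.base g) y)

end LEDisplay

open LEDisplay

namespace LEDisplay

/-! ### Coordinatewise arguments -/

/-! Everything rests on residuation. A display rule isolates one argument of `F_f` or `G_g`, so each
coordinate section of `R_f` and `R_g` is the polar of a single structure and hence stable
(`isLEFrame`). Stable sections give every operation of the complex algebra a residual in every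
coordinate (`FrameData.IsLEFrame.isResiduated`). Completeness, normality, the tense adjunctions, and
soundness of the basic rules, of cut and of the minimal logic hold in any residuated algebra.

The added rules need more. Send a structure to the stable set `gen` that it generates; then `gen x ≤
gen y` iff `x N y`, and `gen` commutes with all structural connectives (`gen_F`, `gen_G`). By
residuation, the value of a linear metastructure is determined by the generators of the stable sets
assigned to its metavariables (`evalMStr_le_of_forall_admissible`). An inequality for the conclusion
of an analytic rule thus reduces to instances in `N`. Since every metavariable of a premise occurs
in the conclusion, the same generators bound each premise instance, which puts it in `N`; closure of
`N` finishes (`soundRule`).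

Passing from generators to arbitrary elements is done one coordinate at a time by
`forall_of_forall_update`, with `C` for generators and `D` for general elements. -/

theorem forall_of_forall_update {n : ℕ} {T : Fin n → Type u} (C D : (i : Fin n) → T i → Prop)
    {P : ((i : Fin n) → T i) → Prop}
    (step : ∀ i w, (∀ v, C i v → P (Function.update w i v)) →
      ∀ v, D i v → P (Function.update w i v))
    (base : ∀ w, (∀ i, C i (w i)) → P w) (w : (i : Fin n) → T i) (hw : ∀ i, D i (w i)) : P w := by
  -- `t` collects the coordinates already relaxed from `C` to `D`; the induction enlarges it to all
  -- coordinates.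
  have key : ∀ (t : Finset (Fin n)) (w : (i : Fin n) → T i), (∀ i ∈ t, D i (w i)) →
      (∀ i, i ∉ t → C i (w i)) → P w := by
    intro t
    induction t using Finset.induction_on with
    | empty => exact fun w _ h => base w fun i => h i (Finset.notMem_empty i)
    | insert a t ha ih =>
      intro w hD hC
      rw [← Function.update_eq_self a w]
      refine step a w (fun v hv => ih _ (fun i hi => ?_) fun i hi => ?_) _
        (hD a (Finset.mem_insert_self a t))
      · rw [Function.update_of_ne (fun h : i = a => ha (h ▸ hi))]
        exact hD i (Finset.mem_insert_of_mem hi)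
      · rcases eq_or_ne i a with rfl | hia
        · simpa using hv
        · rw [Function.update_of_ne hia]
          exact hC i (by simp [hia, hi])
  exact key Finset.univ w (fun i _ => hw i) fun i hi => absurd (Finset.mem_univ i) hi

/-- The order at sort `one`, and its converse at sort `dual`. -/
def OT.le {A : Type u} [LE A] : OT → A → A → Prop
  | .one, a, b => a ≤ b
  | .dual, a, b => b ≤ a

theorem OT.le_refl {A : Type u} [Preorder A] (s : OT) (a : A) : s.le a a := by
  cases s <;> exact _root_.le_refl a

theorem OT.le_trans {A : Type u} [Preorder A] (s : OT) {a b c : A} (h : s.le a b)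
    (h' : s.le b c) : s.le a c := by
  cases s
  · exact _root_.le_trans h h'
  · exact _root_.le_trans h' h

theorem apply_cast {P : OT → Type u} {A : Type u} (e : (s : OT) → P s → A) {s t : OT}
    (h : s = t) (h' : P s = P t) (v : P s) : e t (cast h' v) = e s v := by
  subst h; rfl

/-- Values live in one unsorted lattice, so any sort-indexed map `e` makes the casts of `replaceAt`
disappear. It is applied both to evaluation and to `gen`. -/
theorem apply_replaceAt {P : OT → Type u} {A : Type u} (e : (s : OT) → P s → A) {n : ℕ}
    {s t : Fin n → OT} {r : OT} (i : Fin n) (hi : r = t i) (hne : ∀ j, j ≠ i → s j = t j)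
    (x : (j : Fin n) → P (s j)) (y : P r) :
    (fun j => e (t j) (replaceAt i hi hne x y j)) =
      Function.update (fun j => e (s j) (x j)) i (e r y) := by
  funext j
  rcases eq_or_ne j i with rfl | hj
  · simp only [replaceAt, dif_pos, Function.update_self]
    exact apply_cast e hi _ y
  · simp only [replaceAt, dif_neg hj, Function.update_of_ne hj]
    exact apply_cast e (hne j hj) _ (x j)

/-! ### Algebras with residuated operations -/

namespace LEAlg

variable {S : Sig.{u}} {A : Type u} [CompleteLattice A]

/-- Every operation has a residual in every coordinate. -/
structure IsResiduated (𝔸 : LEAlg S A) : Prop where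
  f : ∀ f i (a : Fin (S.arF f) → A) (b : A), ∃ r, ∀ c,
    𝔸.fOp f (Function.update a i c) ≤ b ↔ (S.epsF f i).le c r
  g : ∀ g i (a : Fin (S.arG g) → A) (b : A), ∃ r, ∀ c,
    b ≤ 𝔸.gOp g (Function.update a i c) ↔ (S.epsG g i).op.le c r

variable {𝔸 : LEAlg S A}

/-- In one coordinate, the bound `𝔸.fOp f b` turns into a residual `r`, and transitivity below `r`
gives the claim; the coordinates are then changed one by one. -/
theorem IsResiduated.f_mono (h𝔸 : 𝔸.IsResiduated) (f : S.F) {a b : Fin (S.arF f) → A}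
    (h : ∀ i, (S.epsF f i).le (a i) (b i)) : 𝔸.fOp f a ≤ 𝔸.fOp f b := by
  refine forall_of_forall_update (fun i c => c = b i) (fun i c => (S.epsF f i).le c (b i))
    (P := fun a => 𝔸.fOp f a ≤ 𝔸.fOp f b) (fun i w hw v hv => ?_) (fun w hw => ?_) a h
  · obtain ⟨r, hr⟩ := h𝔸.f f i w (𝔸.fOp f b)
    exact (hr v).2 (OT.le_trans _ hv ((hr _).1 (hw _ rfl)))
  · rw [show w = b from funext hw]

theorem IsResiduated.g_mono (h𝔸 : 𝔸.IsResiduated) (g : S.G) {a b : Fin (S.arG g) → A}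
    (h : ∀ i, (S.epsG g i).op.le (a i) (b i)) : 𝔸.gOp g b ≤ 𝔸.gOp g a := by
  refine forall_of_forall_update (fun i c => c = b i) (fun i c => (S.epsG g i).op.le c (b i))
    (P := fun a => 𝔸.gOp g b ≤ 𝔸.gOp g a) (fun i w hw v hv => ?_) (fun w hw => ?_) a h
  · obtain ⟨r, hr⟩ := h𝔸.g g i w (𝔸.gOp g b)
    exact (hr v).2 (OT.le_trans _ hv ((hr _).1 (hw _ rfl)))
  · rw [show w = b from funext hw]

/-- Adjoints preserve the relevant joins and meets: both sides have the same bounds `b`, because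
each bound becomes a comparison with `r`. -/
theorem IsResiduated.isComplete (h𝔸 : 𝔸.IsResiduated) : 𝔸.IsComplete where
  f_one f i h a C := eq_of_forall_ge_iff fun b => by
    obtain ⟨r, hr⟩ := h𝔸.f f i a b
    simp only [h, OT.le] at hr
    simp [hr]
  f_dual f i h a C := eq_of_forall_ge_iff fun b => by
    obtain ⟨r, hr⟩ := h𝔸.f f i a b
    simp only [h, OT.le] at hr
    simp [hr]
  g_one g i h a C := eq_of_forall_le_iff fun b => by
    obtain ⟨r, hr⟩ := h𝔸.g g i a b
    simp only [h, OT.op, OT.le] at hr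
    simp [hr]
  g_dual g i h a C := eq_of_forall_le_iff fun b => by
    obtain ⟨r, hr⟩ := h𝔸.g g i a b
    simp only [h, OT.op, OT.le] at hr
    simp [hr]

theorem IsComplete.isNormal (h𝔸 : 𝔸.IsComplete) : 𝔸.IsNormal where
  f_one f i h a := ⟨fun b c => by simpa [iSup_or, iSup_sup_eq] using h𝔸.f_one f i h a {b, c},
    by simpa using h𝔸.f_one f i h a ∅⟩
  f_dual f i h a := ⟨fun b c => by simpa [iSup_or, iSup_sup_eq] using h𝔸.f_dual f i h a {b, c},
    by simpa using h𝔸.f_dual f i h a ∅⟩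
  g_one g i h a := ⟨fun b c => by simpa [iInf_or, iInf_inf_eq] using h𝔸.g_one g i h a {b, c},
    by simpa using h𝔸.g_one g i h a ∅⟩
  g_dual g i h a := ⟨fun b c => by simpa [iInf_or, iInf_inf_eq] using h𝔸.g_dual g i h a {b, c},
    by simpa using h𝔸.g_dual g i h a ∅⟩

/-- The set whose supremum or infimum defines the tense operation is `Set.Iic r` or `Set.Ici r`, so
that operation returns the residual `r` itself. -/
theorem IsResiduated.isTense (h𝔸 : 𝔸.IsResiduated) : 𝔸.tense.IsTense where
  f_one f i h a b := by
    obtain ⟨r, hr⟩ := h𝔸.f f i a b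
    simp only [h, OT.le] at hr
    have e : {c | 𝔸.fOp f (Function.update a i c) ≤ b} = Set.Iic r := Set.ext hr
    simpa [tense, e] using hr (a i)
  f_dual f i h a b := by
    obtain ⟨r, hr⟩ := h𝔸.f f i a b
    simp only [h, OT.le] at hr
    have e : {c | 𝔸.fOp f (Function.update a i c) ≤ b} = Set.Ici r := Set.ext hr
    simpa [tense, e] using hr (a i)
  g_one g i h a b := by
    obtain ⟨r, hr⟩ := h𝔸.g g i a b
    simp only [h, OT.op, OT.le] at hr
    have e : {c | b ≤ 𝔸.gOp g (Function.update a i c)} = Set.Ici r := Set.ext hr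
    simpa [tense, e] using hr (a i)
  g_dual g i h a b := by
    obtain ⟨r, hr⟩ := h𝔸.g g i a b
    simp only [h, OT.op, OT.le] at hr
    have e : {c | b ≤ 𝔸.gOp g (Function.update a i c)} = Set.Iic r := Set.ext hr
    simpa [tense, e] using hr (a i)

namespace IsTense

variable {𝔹 : LEAlg S.star A}

/-- The adjunction read from the residual's side: apply it to the tuple updated by `b`, with `a i`
as the bound. -/
theorem sharp_one (h𝔹 : 𝔹.IsTense) (f : S.F) (i) (h : S.epsF f i = OT.one)
    (a : Fin (S.arF f) → A) (b : A) :
    b ≤ 𝔹.gOp (.sharp f i h) a ↔ 𝔹.fOp (.base f) (Function.update a i b) ≤ a i := by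
  simp [h𝔹.f_one f i h]

theorem sharp_dual (h𝔹 : 𝔹.IsTense) (f : S.F) (i) (h : S.epsF f i = OT.dual)
    (a : Fin (S.arF f) → A) (b : A) :
    𝔹.fOp (.sharp f i h) a ≤ b ↔ 𝔹.fOp (.base f) (Function.update a i b) ≤ a i := by
  simp [h𝔹.f_dual f i h]

theorem flat_one (h𝔹 : 𝔹.IsTense) (g : S.G) (i) (h : S.epsG g i = OT.one)
    (a : Fin (S.arG g) → A) (b : A) :
    𝔹.fOp (.flat g i h) a ≤ b ↔ a i ≤ 𝔹.gOp (.base g) (Function.update a i b) := by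
  simp [h𝔹.g_one g i h]

theorem flat_dual (h𝔹 : 𝔹.IsTense) (g : S.G) (i) (h : S.epsG g i = OT.dual)
    (a : Fin (S.arG g) → A) (b : A) :
    b ≤ 𝔹.gOp (.flat g i h) a ↔ a i ≤ 𝔹.gOp (.base g) (Function.update a i b) := by
  simp [h𝔹.g_dual g i h]

end IsTense

/-- An inequality for a residual in coordinate `i` is one for the base connective. Varying
coordinate `i` varies the bound, so the base connective supplies the witness; varying another
coordinate `j` uses the base residual at `j`. The values of `resEps` are the resulting directions.
-/
theorem IsResiduated.tense (h𝔸 : 𝔸.IsResiduated) : 𝔸.tense.IsResiduated where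
  f
    | .base f => h𝔸.f f
    | .sharp f i h => fun (j : Fin (S.arF f)) a b => by
      simp only [h𝔸.isTense.sharp_dual]
      rcases eq_or_ne j i with rfl | hj
      · exact ⟨𝔸.fOp f (Function.update a j b), fun c => by
          simp [Sig.star, resEps_self, h, OT.le, LEAlg.tense]⟩
      · obtain ⟨r, hr⟩ := h𝔸.f f j (Function.update a i b) (a i)
        refine ⟨r, fun c => ?_⟩
        rw [Function.update_comm hj, Function.update_of_ne hj.symm]
        simp only [Sig.star, resEps_of_dual h hj]
        exact hr c
    | .flat g i h => fun (j : Fin (S.arG g)) a b => by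
      simp only [h𝔸.isTense.flat_one]
      rcases eq_or_ne j i with rfl | hj
      · exact ⟨𝔸.gOp g (Function.update a j b), fun c => by
          simp [Sig.star, resEps_self, h, OT.le, LEAlg.tense]⟩
      · obtain ⟨r, hr⟩ := h𝔸.g g j (Function.update a i b) (a i)
        refine ⟨r, fun c => ?_⟩
        rw [Function.update_comm hj, Function.update_of_ne hj.symm]
        simp only [Sig.star, resEps_of_one h hj]
        exact hr c
  g
    | .base g => h𝔸.g g
    | .sharp f i h => fun (j : Fin (S.arF f)) a b => by
      simp only [h𝔸.isTense.sharp_one]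
      rcases eq_or_ne j i with rfl | hj
      · exact ⟨𝔸.fOp f (Function.update a j b), fun c => by
          simp [Sig.star, resEps_self, h, OT.op, OT.le, LEAlg.tense]⟩
      · obtain ⟨r, hr⟩ := h𝔸.f f j (Function.update a i b) (a i)
        refine ⟨r, fun c => ?_⟩
        rw [Function.update_comm hj, Function.update_of_ne hj.symm]
        simp only [Sig.star, resEps_of_one h hj, OT.op_op]
        exact hr c
    | .flat g i h => fun (j : Fin (S.arG g)) a b => by
      simp only [h𝔸.isTense.flat_dual]
      rcases eq_or_ne j i with rfl | hj
      · exact ⟨𝔸.gOp g (Function.update a j b), fun c => by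
          simp [Sig.star, resEps_self, h, OT.op, OT.le, LEAlg.tense]⟩
      · obtain ⟨r, hr⟩ := h𝔸.g g j (Function.update a i b) (a i)
        refine ⟨r, fun c => ?_⟩
        rw [Function.update_comm hj, Function.update_of_ne hj.symm]
        simp only [Sig.star, resEps_of_dual h hj]
        exact hr c

/-! ### Soundness -/

variable {Atom : Type u}

theorem sat_towards (V : Atom → A) (s : OT) (x : Str S Atom s) (φ : Fm S Atom) :
    𝔸.Sat V (Sqt.towards s x φ) ↔ s.le (𝔸.evalStr V x) (𝔸.evalFm V φ) := by
  cases s <;> simp [Sat, Sqt.towards, OT.le, evalStr]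

theorem IsResiduated.sat_iff_of_display (h𝔸 : 𝔸.IsResiduated) (V : Atom → A) {a b : Sqt S Atom}
    (h : Display a b) : 𝔸.Sat V a ↔ 𝔸.Sat V b := by
  -- With the sort explicit, `apply_cast` and `apply_replaceAt` turn the display rule into the tense
  -- adjunction.
  let e (s : OT) (x : Str S Atom s) : A := 𝔸.evalStr V x
  have ht := h𝔸.isTense
  cases h with
  | f_one f i h x y =>
    exact (ht.f_one f i h (fun j => e _ (x j)) (e _ y)).trans (iff_of_eq (congrArg₂ (· ≤ ·)
      (apply_cast e h _ (x i)).symm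
      (congrArg (𝔸.tense.gOp (.sharp f i h)) (apply_replaceAt e i _ _ x y).symm)))
  | f_dual f i h x y =>
    exact (ht.f_dual f i h (fun j => e _ (x j)) (e _ y)).trans (iff_of_eq (congrArg₂ (· ≤ ·)
      (congrArg (𝔸.tense.fOp (.sharp f i h)) (apply_replaceAt e i _ _ x y).symm)
      (apply_cast e h _ (x i)).symm))
  | g_one g i h y x =>
    exact (ht.g_one g i h (fun j => e _ (y j)) (e _ x)).trans (iff_of_eq (congrArg₂ (· ≤ ·)
      (congrArg (𝔸.tense.fOp (.flat g i h)) (apply_replaceAt e i _ _ y x).symm)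
      (apply_cast e (congrArg OT.op h) _ (y i)).symm))
  | g_dual g i h y x =>
    exact (ht.g_dual g i h (fun j => e _ (y j)) (e _ x)).trans (iff_of_eq (congrArg₂ (· ≤ ·)
      (apply_cast e (congrArg OT.op h) _ (y i)).symm
      (congrArg (𝔸.tense.gOp (.flat g i h)) (apply_replaceAt e i _ _ y x).symm)))

theorem IsResiduated.soundInstance_basic (h𝔸 : 𝔸.IsResiduated) {prems : List (Sqt S Atom)}
    {concl : Sqt S Atom} (h : BasicRule prems concl) : 𝔸.SoundInstance prems concl := by
  intro V hV
  cases h with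
  | id p => exact le_rfl
  | display h => exact (h𝔸.sat_iff_of_display V h).1 (hV _ (by simp))
  | displayInv h => exact (h𝔸.sat_iff_of_display V h).2 (hV _ (by simp))
  | bot y => simp [Sat, evalStr, evalFm]
  | top x => simp [Sat, evalStr, evalFm]
  | andL₁ φ ψ y => exact inf_le_of_left_le (hV ⟨.fm φ, y⟩ (by simp))
  | andL₂ φ ψ y => exact inf_le_of_right_le (hV ⟨.fm ψ, y⟩ (by simp))
  | orR₁ φ ψ x => exact le_sup_of_le_left (hV ⟨x, .fm φ⟩ (by simp))
  | orR₂ φ ψ x => exact le_sup_of_le_right (hV ⟨x, .fm ψ⟩ (by simp))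
  | andR φ ψ x =>
    exact le_inf (hV ⟨x, .fm φ⟩ (by simp)) (hV ⟨x, .fm ψ⟩ (by simp))
  | orL φ ψ y =>
    exact sup_le (hV ⟨.fm φ, y⟩ (by simp)) (hV ⟨.fm ψ, y⟩ (by simp))
  | fL f φ y => simpa [Sat, evalStr, evalFm, LEAlg.tense] using hV _ (List.mem_singleton_self _)
  | fR f φ x =>
    exact h𝔸.f_mono f fun i => (sat_towards V _ _ _).1 (hV _ (List.mem_ofFn.2 ⟨i, rfl⟩))
  | gL g ψ x => simpa [Sat, evalStr, evalFm, LEAlg.tense] using hV _ (List.mem_singleton_self _)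
  | gR g ψ y =>
    exact h𝔸.g_mono g fun i => (sat_towards V _ _ _).1 (hV _ (List.mem_ofFn.2 ⟨i, rfl⟩))

theorem evalStr_inst (V : Atom → A) (η : (s : OT) → ℕ → Str S Atom s) {s : OT} (t : MStr S s) :
    𝔸.evalStr V (t.inst η) = 𝔸.evalMStr (fun s k => 𝔸.evalStr V (η s k)) t := by
  induction t with
  | var k => rfl
  | F f x ih => simp only [MStr.inst, evalStr, evalMStr, ih]
  | G g y ih => simp only [MStr.inst, evalStr, evalMStr, ih]

theorem SoundRule.soundInstance {R : StructRule S} (hR : 𝔸.SoundRule R)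
    (η : (s : OT) → ℕ → Str S Atom s) :
    𝔸.SoundInstance (R.prems.map (MSqt.inst η)) (R.concl.inst η) := by
  intro V hV
  simp only [Sat, MSqt.inst, evalStr_inst, List.forall_mem_map] at hV ⊢
  exact hR _ hV

/-- Cut is transitivity of `≤`, so only the added rules demand anything beyond residuation. -/
theorem IsResiduated.soundInstance (h𝔸 : 𝔸.IsResiduated) {D : Calculus S}
    (hD : ∀ R ∈ D.extra, 𝔸.SoundRule R) {prems : List (Sqt S Atom)} {concl : Sqt S Atom}
    (h : D.IsRule prems concl) : 𝔸.SoundInstance prems concl := by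
  rcases h with h | ⟨-, ⟨x, φ, y⟩⟩ | ⟨R, hR, η, rfl, rfl⟩
  · exact h𝔸.soundInstance_basic h
  · intro V hV
    exact le_trans (hV ⟨x, .fm φ⟩ (by simp)) (hV ⟨.fm φ, y⟩ (by simp))
  · exact (hD R hR).soundInstance η

theorem IsResiduated.sat_of_derivable (h𝔸 : 𝔸.IsResiduated) {D : Calculus S}
    (hD : ∀ R ∈ D.extra, 𝔸.SoundRule R) (V : Atom → A) {a : Sqt S Atom} (h : D.Derivable a) :
    𝔸.Sat V a := by
  induction h with
  | step prems concl h _ ih => exact h𝔸.soundInstance hD h V ih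

theorem evalFm_update (V : Atom → A) {n : ℕ} (a : Fin n → Fm S Atom) (i : Fin n)
    (φ : Fm S Atom) : (fun j => 𝔸.evalFm V (Function.update a i φ j)) =
      Function.update (fun j => 𝔸.evalFm V (a j)) i (𝔸.evalFm V φ) :=
  Function.comp_update (𝔸.evalFm V) a i φ

theorem evalFm_subst (V : Atom → A) (σ : Atom → Fm S Atom) (φ : Fm S Atom) :
    𝔸.evalFm V (φ.subst σ) = 𝔸.evalFm (fun p => 𝔸.evalFm V (σ p)) φ := by
  induction φ with
  | atom p => rfl
  | bot => rfl
  | top => rfl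
  | and φ ψ ih₁ ih₂ => simp only [Fm.subst, evalFm, ih₁, ih₂]
  | or φ ψ ih₁ ih₂ => simp only [Fm.subst, evalFm, ih₁, ih₂]
  | f k φ ih => simp only [Fm.subst, evalFm, ih]
  | g k φ ih => simp only [Fm.subst, evalFm, ih]

theorem le_update {n : ℕ} (ε : Fin n → OT) (a : Fin n → A) (i : Fin n) {b c : A}
    (h : (ε i).le b c) (j : Fin n) :
    (ε j).le (Function.update a i b j) (Function.update a i c j) := by
  rcases eq_or_ne j i with rfl | hj
  · simpa using h
  · simpa [hj] using OT.le_refl _ _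

theorem IsResiduated.valid_of_logic (h𝔸 : 𝔸.IsResiduated) {Ax : Set (Fm S Atom × Fm S Atom)}
    (hAx : ∀ a ∈ Ax, 𝔸.Valid a.1 a.2) {φ ψ : Fm S Atom} (h : Logic Ax φ ψ) : 𝔸.Valid φ ψ := by
  have hn := h𝔸.isComplete.isNormal
  induction h with
  | ax h => exact hAx _ h
  | refl φ => exact fun V => le_rfl
  | bot φ => exact fun V => bot_le
  | top φ => exact fun V => le_top
  | or₁ φ ψ => exact fun V => le_sup_left
  | or₂ φ ψ => exact fun V => le_sup_right
  | and₁ φ ψ => exact fun V => inf_le_left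
  | and₂ φ ψ => exact fun V => inf_le_right
  | f_bot f i h a =>
    intro V; simp only [evalFm, evalFm_update]; exact ((hn.f_one f i h _).2).le
  | f_top f i h a =>
    intro V; simp only [evalFm, evalFm_update]; exact ((hn.f_dual f i h _).2).le
  | g_top g i h a =>
    intro V; simp only [evalFm, evalFm_update]; exact ((hn.g_one g i h _).2).ge
  | g_bot g i h a =>
    intro V; simp only [evalFm, evalFm_update]; exact ((hn.g_dual g i h _).2).ge
  | f_or f i h a φ ψ =>
    intro V; simp only [evalFm, evalFm_update]; exact ((hn.f_one f i h _).1 _ _).le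
  | f_and f i h a φ ψ =>
    intro V; simp only [evalFm, evalFm_update]; exact ((hn.f_dual f i h _).1 _ _).le
  | g_and g i h a φ ψ =>
    intro V; simp only [evalFm, evalFm_update]; exact ((hn.g_one g i h _).1 _ _).ge
  | g_or g i h a φ ψ =>
    intro V; simp only [evalFm, evalFm_update]; exact ((hn.g_dual g i h _).1 _ _).ge
  | trans _ _ ih₁ ih₂ => exact fun V => (ih₁ V).trans (ih₂ V)
  -- Substitution changes the valuation, hence the induction is on validity under all valuations.
  | subst σ _ ih => intro V; simp only [evalFm_subst]; exact ih _
  | and _ _ ih₁ ih₂ => exact fun V => le_inf (ih₁ V) (ih₂ V)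
  | or _ _ ih₁ ih₂ => exact fun V => sup_le (ih₁ V) (ih₂ V)
  | f_mono f i h a _ ih =>
    intro V; simp only [evalFm, evalFm_update]
    exact h𝔸.f_mono f (le_update _ _ i (by rw [h]; exact ih V))
  | f_anti f i h a _ ih =>
    intro V; simp only [evalFm, evalFm_update]
    exact h𝔸.f_mono f (le_update _ _ i (by rw [h]; exact ih V))
  | g_mono g i h a _ ih =>
    intro V; simp only [evalFm, evalFm_update]
    exact h𝔸.g_mono g (le_update (fun j => (S.epsG g j).op) _ i (by rw [h]; exact ih V))
  | g_anti g i h a _ ih =>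
    intro V; simp only [evalFm, evalFm_update]
    exact h𝔸.g_mono g (le_update (fun j => (S.epsG g j).op) _ i (by rw [h]; exact ih V))

end LEAlg

theorem OT.eq_one_or_eq_dual (s : OT) : s = .one ∨ s = .dual := by cases s <;> simp

/-! ### Complex algebras -/

namespace FrameData

variable {S : Sig.{u}} {𝔽 : FrameData S}

theorem isStable_iff_exists_side {s : OT} {Z : Set (𝔽.pt s)} :
    𝔽.IsStable s Z ↔ ∃ c : 𝔽.Stable, side c s = Z := by
  cases s
  · exact Order.isExtent_iff.symm.trans Concept.isExtent_iff_exists_concept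
  · exact Order.isIntent_iff.symm.trans Concept.isIntent_iff_exists_concept

theorem side_subset_side_iff {s : OT} {c d : 𝔽.Stable} :
    side c s ⊆ side d s ↔ s.le c d := by
  cases s
  · exact Concept.extent_subset_extent_iff
  · exact Concept.intent_subset_intent_iff

theorem IsStable.iInter {ι : Sort*} {s : OT} {Z : ι → Set (𝔽.pt s)}
    (h : ∀ i, 𝔽.IsStable s (Z i)) : 𝔽.IsStable s (⋂ i, Z i) := by
  cases s
  · exact Order.isExtent_iff.1 (.iInter _ fun i => Order.isExtent_iff.2 (h i))
  · exact Order.isIntent_iff.1 (.iInter _ fun i => Order.isIntent_iff.2 (h i))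

/-- The stable set generated by a point. -/
def principal (𝔽 : FrameData S) : (s : OT) → 𝔽.pt s → 𝔽.Stable
  | .one, w => Concept.ofObject 𝔽.N w
  | .dual, u => Concept.ofAttribute 𝔽.N u

theorem mem_side_iff {s : OT} {v : 𝔽.pt s} {c : 𝔽.Stable} :
    v ∈ side c s ↔ s.le (𝔽.principal s v) c := by
  cases s
  · exact (Concept.ofObjects_le_iff.trans Set.singleton_subset_iff).symm
  · exact (Concept.le_ofAttributes_iff.trans Set.singleton_subset_iff).symm

theorem principal_one_le_principal_dual {w : 𝔽.pt .one} {u : 𝔽.pt .dual} :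
    𝔽.principal .one w ≤ 𝔽.principal .dual u ↔ 𝔽.N w u :=
  Concept.ofObject_le_ofAttribute_iff

/-- A concept is determined by its intent, that is, by the points of `U` whose stable sets lie above
it. -/
theorem eq_principal_one {w : 𝔽.pt .one} {c : 𝔽.Stable}
    (h : ∀ u, c ≤ 𝔽.principal .dual u ↔ 𝔽.N w u) : 𝔽.principal .one w = c :=
  Concept.ext' <| Set.ext fun u =>
    (mem_side_iff (s := .dual)).trans <| principal_one_le_principal_dual.trans <|
      (h u).symm.trans (mem_side_iff (s := .dual)).symm

theorem eq_principal_dual {u : 𝔽.pt .dual} {c : 𝔽.Stable}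
    (h : ∀ w, 𝔽.principal .one w ≤ c ↔ 𝔽.N w u) : 𝔽.principal .dual u = c :=
  Concept.ext <| Set.ext fun w =>
    (mem_side_iff (s := .one)).trans <| principal_one_le_principal_dual.trans <|
      (h w).symm.trans (mem_side_iff (s := .one)).symm

namespace IsLEFrame

variable (h𝔽 : 𝔽.IsLEFrame)

theorem isIntent_zeroF (h𝔽 : 𝔽.IsLEFrame) (f : S.F)
    (X : (i : Fin (S.arF f)) → Set (𝔽.pt (S.epsF f i))) : Order.IsIntent 𝔽.N (𝔽.zeroF f X) := by
  have key : 𝔽.zeroF f X =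
      ⋂ (w : (i : Fin (S.arF f)) → 𝔽.pt (S.epsF f i)) (_ : ∀ i, w i ∈ X i),
        𝔽.zeroF f (fun i => {w i}) := by
    ext u
    simp only [zeroF, Set.mem_ofPred_eq, Set.mem_iInter, Set.mem_singleton_iff]
    constructor
    · intro h w hw v hv
      obtain rfl : v = w := funext hv
      exact h v hw
    · intro h w hw
      exact h w hw w fun _ => rfl
  rw [key]
  exact Order.IsIntent.iInter₂ _ fun w _ => Order.isIntent_iff.2 (h𝔽.f_zero f w)

theorem fOp_le_principal_iff {f : S.F} {X : Fin (S.arF f) → 𝔽.Stable} {u : 𝔽.pt .dual} :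
    (𝔽.complexAlg h𝔽).fOp f X ≤ 𝔽.principal .dual u ↔
      ∀ w, (∀ i, w i ∈ side (X i) (S.epsF f i)) → 𝔽.RF f u w := by
  refine (mem_side_iff (s := .dual)).symm.trans ?_
  change u ∈ (Concept.ofAttributes 𝔽.N _).intent ↔ _
  -- The set is already stable, so closing it adds no points.
  rw [Concept.intent_ofAttributes_of_isIntent (h𝔽.isIntent_zeroF f _)]
  rfl

theorem principal_le_gOp_iff {g : S.G} {X : Fin (S.arG g) → 𝔽.Stable} {w : 𝔽.pt .one} :
    𝔽.principal .one w ≤ (𝔽.complexAlg h𝔽).gOp g X ↔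
      ∀ u, (∀ i, u i ∈ side (X i) (S.epsG g i).op) → 𝔽.RG g w u :=
  (mem_side_iff (s := .one)).symm

theorem le_iff_forall_principal_dual {c d : 𝔽.Stable} :
    c ≤ d ↔ ∀ u, d ≤ 𝔽.principal .dual u → c ≤ 𝔽.principal .dual u :=
  (side_subset_side_iff (s := .dual)).symm.trans <| forall_congr' fun _ =>
    imp_congr (mem_side_iff (s := .dual)) (mem_side_iff (s := .dual))

theorem le_iff_forall_principal_one {c d : 𝔽.Stable} :
    c ≤ d ↔ ∀ w, 𝔽.principal .one w ≤ c → 𝔽.principal .one w ≤ d :=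
  (side_subset_side_iff (s := .one)).symm.trans <| forall_congr' fun _ =>
    imp_congr (mem_side_iff (s := .one)) (mem_side_iff (s := .one))

theorem exists_forall_le_iff_mem {s : OT} {Z : Set (𝔽.pt s)} (hZ : 𝔽.IsStable s Z) :
    ∃ r : 𝔽.Stable, ∀ c, s.le c r ↔ ∀ v ∈ side c s, v ∈ Z := by
  obtain ⟨r, rfl⟩ := isStable_iff_exists_side.1 hZ
  exact ⟨r, fun c => side_subset_side_iff.symm⟩

/-- The residual is the intersection of the sections in coordinate `i`, over all points bounding `b`
and all choices of points for the other coordinates. Each section is stable by the frame conditions,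
so the intersection is too. The `i`-th entry of the chosen tuple is overwritten and therefore
unconstrained. -/
theorem isResiduated : (𝔽.complexAlg h𝔽).IsResiduated where
  f f i a b := by
    obtain ⟨r, hr⟩ := exists_forall_le_iff_mem (s := S.epsF f i)
      (.iInter fun u : {u // b ≤ 𝔽.principal .dual u} => .iInter
        fun w : {w : (j : Fin (S.arF f)) → 𝔽.pt (S.epsF f j) // ∀ j, j ≠ i → w j ∈ side (a j) _} =>
          h𝔽.f_coord f u w i)
    refine ⟨r, fun c => ?_⟩
    simp only [hr, le_iff_forall_principal_dual (d := b), fOp_le_principal_iff, Set.mem_iInter,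
      Subtype.forall]
    constructor
    · intro h v hv u hu w hw
      refine h u hu _ fun j => ?_
      rcases eq_or_ne j i with rfl | hj
      · simpa using hv
      · simpa [hj] using hw j hj
    · intro h u hu w hw
      have := h (w i) (by simpa using hw i) u hu w fun j hj => by simpa [hj] using hw j
      simpa using this
  g g i a b := by
    obtain ⟨r, hr⟩ := exists_forall_le_iff_mem (s := (S.epsG g i).op)
      (.iInter fun w : {w // 𝔽.principal .one w ≤ b} => .iInter
        fun u : {u : (j : Fin (S.arG g)) → 𝔽.pt (S.epsG g j).op //
            ∀ j, j ≠ i → u j ∈ side (a j) _} =>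
          h𝔽.g_coord g w u i)
    refine ⟨r, fun c => ?_⟩
    simp only [hr, le_iff_forall_principal_one (c := b), principal_le_gOp_iff, Set.mem_iInter,
      Subtype.forall]
    constructor
    · intro h v hv w hw u hu
      refine h w hw _ fun j => ?_
      rcases eq_or_ne j i with rfl | hj
      · simpa using hv
      · simpa [hj] using hu j hj
    · intro h w hw u hu
      have := h (u i) (by simpa using hu i) w hw u fun j hj => by simpa [hj] using hu j
      simpa using this

theorem forall_mem_side_principal {s : OT} {Z : Set (𝔽.pt s)} (hZ : 𝔽.IsStable s Z) {v : 𝔽.pt s}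
    (hv : v ∈ Z) : ∀ v' ∈ side (𝔽.principal s v) s, v' ∈ Z := by
  obtain ⟨r, rfl⟩ := isStable_iff_exists_side.1 hZ
  exact side_subset_side_iff.2 (mem_side_iff.1 hv)

/-- A stable section containing `w i` contains the whole stable set generated by `w i`, so one
related tuple suffices. -/
theorem fOp_principal_le_principal_iff {f : S.F} {w : (i : Fin (S.arF f)) → 𝔽.pt (S.epsF f i)}
    {u : 𝔽.pt .dual} :
    (𝔽.complexAlg h𝔽).fOp f (fun i => 𝔽.principal _ (w i)) ≤ 𝔽.principal .dual u ↔
      𝔽.RF f u w := by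
  rw [fOp_le_principal_iff]
  refine ⟨fun h => h w fun i => mem_side_iff.2 (OT.le_refl _ _), fun h w' => ?_⟩
  refine forall_of_forall_update (fun i v => v = w i)
    (fun i v => v ∈ side (𝔽.principal _ (w i)) _) (P := 𝔽.RF f u) (fun i x hx => ?_)
    (fun x hx => funext hx ▸ h) w'
  exact forall_mem_side_principal (h𝔽.f_coord f u x i) (hx _ rfl)

theorem principal_le_gOp_principal_iff {g : S.G}
    {u : (i : Fin (S.arG g)) → 𝔽.pt (S.epsG g i).op} {w : 𝔽.pt .one} :
    𝔽.principal .one w ≤ (𝔽.complexAlg h𝔽).gOp g (fun i => 𝔽.principal _ (u i)) ↔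
      𝔽.RG g w u := by
  rw [principal_le_gOp_iff]
  refine ⟨fun h => h u fun i => mem_side_iff.2 (OT.le_refl _ _), fun h u' => ?_⟩
  refine forall_of_forall_update (fun i v => v = u i)
    (fun i v => v ∈ side (𝔽.principal _ (u i)) _) (P := 𝔽.RG g w) (fun i x hx => ?_)
    (fun x hx => funext hx ▸ h) u'
  exact forall_mem_side_principal (h𝔽.g_coord g w x i) (hx _ rfl)

end IsLEFrame

end FrameData

/-! ### Functional frames -/

theorem cast_replaceAt_self {P : OT → Type u} {n : ℕ} {s t : Fin n → OT} {r : OT} (i : Fin n)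
    (hi : r = t i) (hne : ∀ j, j ≠ i → s j = t j) (x : (j : Fin n) → P (s j)) (y : P r)
    (h : P (t i) = P r) : cast h (replaceAt i hi hne x y i) = y := by
  simp [replaceAt]

theorem replaceAt_update {P : OT → Type u} {n : ℕ} {s t : Fin n → OT} {r : OT} (i : Fin n)
    (hi : r = t i) (hne : ∀ j, j ≠ i → s j = t j) (x : (j : Fin n) → P (s j)) (v : P (s i))
    (y : P r) : replaceAt i hi hne (Function.update x i v) y = replaceAt i hi hne x y := by
  funext j
  by_cases hj : j = i <;> simp [replaceAt, hj]

/-- This exhibits an arbitrary tuple under a residual connective as the tuple in the lower sequent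
of a display rule. -/
theorem replaceAt_replaceAt {P : OT → Type u} {n : ℕ} {s t : Fin n → OT} {r r' : OT} (i : Fin n)
    (hi : r = t i) (hne : ∀ j, j ≠ i → s j = t j) (hi' : r' = s i)
    (hne' : ∀ j, j ≠ i → t j = s j) (x : (j : Fin n) → P (s j)) (y : P r)
    (h : P (s i) = P r') :
    replaceAt i hi' hne' (replaceAt i hi hne x y) (cast h (x i)) = x := by
  funext j
  by_cases hj : j = i
  · subst hj; simp [replaceAt]
  · simp [replaceAt, hj]

namespace FunctionalFrame

variable {S : Sig.{u}} {Atom : Type u} {D : Calculus S} (𝔽 : FunctionalFrame Atom D)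

theorem N_iff_of_display {a b : Sqt S Atom} (h : Display a b) :
    𝔽.N a.ant a.suc ↔ 𝔽.N b.ant b.suc :=
  ⟨fun ha => 𝔽.closed [a] b (.inl (.display h)) (by simpa using ha),
    fun hb => 𝔽.closed [b] a (.inl (.displayInv h)) (by simpa using hb)⟩

/-- Such a `Z` is the polar of the single point `y`. The sort is a variable because `S.epsF f i`
equals `one` only propositionally. -/
theorem isStable_of_one {s : OT} (hs : s = .one) {Z : Set (Str S Atom s)} {y : Str S Atom .dual}
    (h : ∀ v, v ∈ Z ↔ 𝔽.N (cast (congrArg (Str S Atom) hs) v) y) : 𝔽.frame.IsStable s Z := by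
  subst hs
  obtain rfl : Z = lowerPolar 𝔽.N {y} := by ext v; simp [h]
  exact lowerPolar_upperPolar_lowerPolar _ _

theorem isStable_of_dual {s : OT} (hs : s = .dual) {Z : Set (Str S Atom s)}
    {x : Str S Atom .one}
    (h : ∀ v, v ∈ Z ↔ 𝔽.N x (cast (congrArg (Str S Atom) hs) v)) : 𝔽.frame.IsStable s Z := by
  subst hs
  obtain rfl : Z = upperPolar 𝔽.N {x} := by ext v; simp [h]
  exact upperPolar_lowerPolar_upperPolar _ _

/-- After the display rule, the varying argument stands alone on one side, and by `replaceAt_update`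
the other side does not depend on it. -/
theorem isLEFrame : 𝔽.frame.IsLEFrame where
  f_zero f w := by
    refine 𝔽.isStable_of_dual (x := .F (.base f) w) rfl fun u => ?_
    exact ⟨fun h => h w fun i => rfl, fun h w' hw' => by
      obtain rfl : w' = w := funext hw'
      exact h⟩
  f_coord f u₀ w i := by
    obtain h | h := (S.epsF f i).eq_one_or_eq_dual
    · exact 𝔽.isStable_of_one h fun v =>
        (𝔽.N_iff_of_display (.f_one f i h (Function.update w i v) u₀)).trans <|
          iff_of_eq <| congrArg₂ 𝔽.N
          (congrArg (cast _)
            (Function.update_self (β := fun j => Str S Atom (S.epsF f j)) i v w))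
          (congrArg (Str.G (.sharp f i h)) (replaceAt_update i _ _ w v u₀))
    · exact 𝔽.isStable_of_dual h fun v =>
        (𝔽.N_iff_of_display (.f_dual f i h (Function.update w i v) u₀)).trans <|
          iff_of_eq <| congrArg₂ 𝔽.N
          (congrArg (Str.F (.sharp f i h)) (replaceAt_update i _ _ w v u₀))
          (congrArg (cast _)
            (Function.update_self (β := fun j => Str S Atom (S.epsF f j)) i v w))
  g_zero g u := by
    refine 𝔽.isStable_of_one (y := .G (.base g) u) rfl fun w => ?_
    exact ⟨fun h => h u fun i => rfl, fun h u' hu' => by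
      obtain rfl : u' = u := funext hu'
      exact h⟩
  g_coord g w₀ u i := by
    obtain h | h := (S.epsG g i).eq_one_or_eq_dual
    · exact 𝔽.isStable_of_dual (congrArg OT.op h) fun v =>
        (𝔽.N_iff_of_display (.g_one g i h (Function.update u i v) w₀)).trans <|
          iff_of_eq <| congrArg₂ 𝔽.N
          (congrArg (Str.F (.flat g i h)) (replaceAt_update i _ _ u v w₀))
          (congrArg (cast _)
            (Function.update_self (β := fun j => Str S Atom (S.epsG g j).op) i v u))
    · exact 𝔽.isStable_of_one (congrArg OT.op h) fun v =>
        (𝔽.N_iff_of_display (.g_dual g i h (Function.update u i v) w₀)).trans <|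
          iff_of_eq <| congrArg₂ 𝔽.N
          (congrArg (cast _)
            (Function.update_self (β := fun j => Str S Atom (S.epsG g j).op) i v u))
          (congrArg (Str.G (.flat g i h)) (replaceAt_update i _ _ u v w₀))

/-- The complex algebra of a functional frame. -/
abbrev alg : LEAlg S 𝔽.frame.Stable := 𝔽.frame.complexAlg 𝔽.isLEFrame

/-- The stable set generated by a structure. -/
abbrev gen (s : OT) (x : Str S Atom s) : 𝔽.frame.Stable := 𝔽.frame.principal s x

theorem gen_le_gen {x : Str S Atom .one} {y : Str S Atom .dual} :
    𝔽.gen .one x ≤ 𝔽.gen .dual y ↔ 𝔽.N x y :=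
  FrameData.principal_one_le_principal_dual

theorem eq_gen_one {x : Str S Atom .one} {c : 𝔽.frame.Stable}
    (h : ∀ y : Str S Atom .dual, c ≤ 𝔽.gen .dual y ↔ 𝔽.N x y) : 𝔽.gen .one x = c :=
  FrameData.eq_principal_one h

theorem eq_gen_dual {y : Str S Atom .dual} {c : 𝔽.frame.Stable}
    (h : ∀ x : Str S Atom .one, 𝔽.gen .one x ≤ c ↔ 𝔽.N x y) : 𝔽.gen .dual y = c :=
  FrameData.eq_principal_dual h

/-! ### Generation of stable sets commutes with the structural connectives -/

theorem gen_F_base (f : S.F) (x : (i : Fin (S.arF f)) → Str S Atom (S.epsF f i)) :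
    𝔽.gen .one (.F (.base f) x) = 𝔽.alg.fOp f fun i => 𝔽.gen _ (x i) :=
  𝔽.eq_gen_one fun _ => 𝔽.isLEFrame.fOp_principal_le_principal_iff

theorem gen_G_base (g : S.G) (y : (i : Fin (S.arG g)) → Str S Atom (S.epsG g i).op) :
    𝔽.gen .dual (.G (.base g) y) = 𝔽.alg.gOp g fun i => 𝔽.gen _ (y i) :=
  𝔽.eq_gen_dual fun _ => 𝔽.isLEFrame.principal_le_gOp_principal_iff

theorem N_F_sharp_iff (f : S.F) (i : Fin (S.arF f)) (h : S.epsF f i = .dual)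
    (x : (j : Fin (S.arF f)) → Str S Atom (resEps (S.epsF f) i j)) (y : Str S Atom .dual)
    (hi : resEps (S.epsF f) i i = .dual) :
    𝔽.N (.F (.sharp f i h) x) y ↔ 𝔽.N (.F (.base f) (replaceAt (t := S.epsF f) i h.symm
      (fun _ hj => resEps_of_dual h hj) x y))
      (cast (congrArg (Str S Atom) hi) (x i)) := by
  have hd := 𝔽.N_iff_of_display (.f_dual f i h (replaceAt (t := S.epsF f) i h.symm
    (fun _ hj => resEps_of_dual h hj) x y) (cast (congrArg (Str S Atom) hi) (x i)))
  exact (iff_of_eq <| congrArg₂ 𝔽.N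
    (congrArg (Str.F (.sharp f i h)) (replaceAt_replaceAt i _ _ _ _ x y _).symm)
    (cast_replaceAt_self i _ _ x y _).symm).trans hd.symm

/-- Tested against `y`, the adjunction in the algebra and the display rule in `N` both reduce the
claim to the base connective, where `gen_F_base` applies. -/
theorem gen_F_sharp (f : S.F) (i : Fin (S.arF f)) (h : S.epsF f i = .dual)
    (x : (j : Fin (S.arF f)) → Str S Atom (resEps (S.epsF f) i j)) :
    𝔽.gen .one (.F (.sharp f i h) x) =
      𝔽.alg.tense.fOp (.sharp f i h) fun j => 𝔽.gen _ (x j) := by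
  refine 𝔽.eq_gen_one fun y =>
    (𝔽.isLEFrame.isResiduated.isTense.sharp_dual f i h _ _).trans ?_
  have hi : resEps (S.epsF f) i i = .dual := by rw [resEps_self, h]
  have hx := apply_cast 𝔽.gen hi (congrArg (Str S Atom) hi) (x i)
  have hw := apply_replaceAt (t := S.epsF f) 𝔽.gen i h.symm
    (fun _ hj => resEps_of_dual h hj) x y
  have hb := (congrArg (𝔽.alg.fOp f) hw.symm).trans (𝔽.gen_F_base f _).symm
  exact (iff_of_eq (congrArg₂ (· ≤ ·) hb hx.symm)).trans
    (𝔽.gen_le_gen.trans (𝔽.N_F_sharp_iff f i h x y hi).symm)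

theorem N_G_sharp_iff (f : S.F) (i : Fin (S.arF f)) (h : S.epsF f i = .one)
    (x : (j : Fin (S.arF f)) → Str S Atom (resEps (S.epsF f) i j).op) (y : Str S Atom .one)
    (hi : (resEps (S.epsF f) i i).op = .dual) :
    𝔽.N y (.G (.sharp f i h) x) ↔ 𝔽.N (.F (.base f) (replaceAt (t := S.epsF f) i h.symm
      (fun j hj => by rw [resEps_of_one h hj, OT.op_op]) x y))
      (cast (congrArg (Str S Atom) hi) (x i)) := by
  have hd := 𝔽.N_iff_of_display (.f_one f i h (replaceAt (t := S.epsF f) i h.symm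
    (fun j hj => by rw [resEps_of_one h hj, OT.op_op]) x y) (cast (congrArg (Str S Atom) hi) (x i)))
  exact (iff_of_eq <| congrArg₂ 𝔽.N (cast_replaceAt_self i _ _ x y _).symm
    (congrArg (Str.G (.sharp f i h)) (replaceAt_replaceAt i _ _ _ _ x y _).symm)).trans hd.symm

theorem gen_G_sharp (f : S.F) (i : Fin (S.arF f)) (h : S.epsF f i = .one)
    (x : (j : Fin (S.arF f)) → Str S Atom (resEps (S.epsF f) i j).op) :
    𝔽.gen .dual (.G (.sharp f i h) x) =
      𝔽.alg.tense.gOp (.sharp f i h) fun j => 𝔽.gen _ (x j) := by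
  refine 𝔽.eq_gen_dual fun y =>
    (𝔽.isLEFrame.isResiduated.isTense.sharp_one f i h _ _).trans ?_
  have hi : (resEps (S.epsF f) i i).op = .dual := by rw [resEps_self, h]; rfl
  have hx := apply_cast 𝔽.gen hi (congrArg (Str S Atom) hi) (x i)
  have hw := apply_replaceAt (t := S.epsF f) 𝔽.gen i h.symm
    (fun j hj => by rw [resEps_of_one h hj, OT.op_op]) x y
  have hb := (congrArg (𝔽.alg.fOp f) hw.symm).trans (𝔽.gen_F_base f _).symm
  exact (iff_of_eq (congrArg₂ (· ≤ ·) hb hx.symm)).trans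
    (𝔽.gen_le_gen.trans (𝔽.N_G_sharp_iff f i h x y hi).symm)

theorem N_F_flat_iff (g : S.G) (i : Fin (S.arG g)) (h : S.epsG g i = .one)
    (x : (j : Fin (S.arG g)) → Str S Atom (resEps (S.epsG g) i j)) (y : Str S Atom .dual)
    (hi : resEps (S.epsG g) i i = .one) :
    𝔽.N (.F (.flat g i h) x) y ↔ 𝔽.N (cast (congrArg (Str S Atom) hi) (x i))
      (.G (.base g) (replaceAt (t := fun j => (S.epsG g j).op) i (congrArg OT.op h.symm)
      (fun _ hj => resEps_of_one h hj) x y)) := by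
  have hd := 𝔽.N_iff_of_display (.g_one g i h
    (replaceAt (t := fun j => (S.epsG g j).op) i (congrArg OT.op h.symm)
    (fun _ hj => resEps_of_one h hj) x y) (cast (congrArg (Str S Atom) hi) (x i)))
  exact (iff_of_eq <| congrArg₂ 𝔽.N
    (congrArg (Str.F (.flat g i h)) (replaceAt_replaceAt i _ _ _ _ x y _).symm)
    (cast_replaceAt_self i _ _ x y _).symm).trans hd.symm

theorem gen_F_flat (g : S.G) (i : Fin (S.arG g)) (h : S.epsG g i = .one)
    (x : (j : Fin (S.arG g)) → Str S Atom (resEps (S.epsG g) i j)) :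
    𝔽.gen .one (.F (.flat g i h) x) =
      𝔽.alg.tense.fOp (.flat g i h) fun j => 𝔽.gen _ (x j) := by
  refine 𝔽.eq_gen_one fun y =>
    (𝔽.isLEFrame.isResiduated.isTense.flat_one g i h _ _).trans ?_
  have hi : resEps (S.epsG g) i i = .one := by rw [resEps_self, h]
  have hx := apply_cast 𝔽.gen hi (congrArg (Str S Atom) hi) (x i)
  have hw := apply_replaceAt (t := fun j => (S.epsG g j).op) 𝔽.gen i (congrArg OT.op h.symm)
    (fun _ hj => resEps_of_one h hj) x y
  have hb := (congrArg (𝔽.alg.gOp g) hw.symm).trans (𝔽.gen_G_base g _).symm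
  exact (iff_of_eq (congrArg₂ (· ≤ ·) hx.symm hb)).trans
    (𝔽.gen_le_gen.trans (𝔽.N_F_flat_iff g i h x y hi).symm)

theorem N_G_flat_iff (g : S.G) (i : Fin (S.arG g)) (h : S.epsG g i = .dual)
    (x : (j : Fin (S.arG g)) → Str S Atom (resEps (S.epsG g) i j).op) (y : Str S Atom .one)
    (hi : (resEps (S.epsG g) i i).op = .one) :
    𝔽.N y (.G (.flat g i h) x) ↔ 𝔽.N (cast (congrArg (Str S Atom) hi) (x i))
      (.G (.base g) (replaceAt (t := fun j => (S.epsG g j).op) i (congrArg OT.op h.symm)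
      (fun j hj => by rw [resEps_of_dual h hj]) x y)) := by
  have hd := 𝔽.N_iff_of_display (.g_dual g i h
    (replaceAt (t := fun j => (S.epsG g j).op) i (congrArg OT.op h.symm)
    (fun j hj => by rw [resEps_of_dual h hj]) x y) (cast (congrArg (Str S Atom) hi) (x i)))
  exact (iff_of_eq <| congrArg₂ 𝔽.N (cast_replaceAt_self i _ _ x y _).symm
    (congrArg (Str.G (.flat g i h)) (replaceAt_replaceAt i _ _ _ _ x y _).symm)).trans hd.symm

theorem gen_G_flat (g : S.G) (i : Fin (S.arG g)) (h : S.epsG g i = .dual)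
    (x : (j : Fin (S.arG g)) → Str S Atom (resEps (S.epsG g) i j).op) :
    𝔽.gen .dual (.G (.flat g i h) x) =
      𝔽.alg.tense.gOp (.flat g i h) fun j => 𝔽.gen _ (x j) := by
  refine 𝔽.eq_gen_dual fun y =>
    (𝔽.isLEFrame.isResiduated.isTense.flat_dual g i h _ _).trans ?_
  have hi : (resEps (S.epsG g) i i).op = .one := by rw [resEps_self, h]; rfl
  have hx := apply_cast 𝔽.gen hi (congrArg (Str S Atom) hi) (x i)
  have hw := apply_replaceAt (t := fun j => (S.epsG g j).op) 𝔽.gen i (congrArg OT.op h.symm)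
    (fun j hj => by rw [resEps_of_dual h hj]) x y
  have hb := (congrArg (𝔽.alg.gOp g) hw.symm).trans (𝔽.gen_G_base g _).symm
  exact (iff_of_eq (congrArg₂ (· ≤ ·) hx.symm hb)).trans
    (𝔽.gen_le_gen.trans (𝔽.N_G_flat_iff g i h x y hi).symm)

theorem gen_F (f : S.star.F) (x : (i : Fin (S.star.arF f)) → Str S Atom (S.star.epsF f i)) :
    𝔽.gen .one (.F f x) = 𝔽.alg.tense.fOp f fun i => 𝔽.gen _ (x i) :=
  match f with
  | .base f => 𝔽.gen_F_base f x
  | .sharp f i h => 𝔽.gen_F_sharp f i h x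
  | .flat g i h => 𝔽.gen_F_flat g i h x

theorem gen_G (g : S.star.G) (y : (i : Fin (S.star.arG g)) → Str S Atom (S.star.epsG g i).op) :
    𝔽.gen .dual (.G g y) = 𝔽.alg.tense.gOp g fun i => 𝔽.gen _ (y i) :=
  match g with
  | .base g => 𝔽.gen_G_base g y
  | .sharp f i h => 𝔽.gen_G_sharp f i h y
  | .flat g i h => 𝔽.gen_G_flat g i h y

end FunctionalFrame

/-! ### Analytic structural rules -/

variable {S : Sig.{u}} {Atom : Type u}

theorem MStr.inst_congr {η η' : (s : OT) → ℕ → Str S Atom s} {s : OT} (t : MStr S s)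
    (h : ∀ r k, t.count r k ≠ 0 → η r k = η' r k) : t.inst η = t.inst η' := by
  induction t with
  | var k => exact h _ k (by simp [MStr.count])
  | F f x ih =>
    refine congrArg (Str.F f) (funext fun i => ih i fun r k hk => h r k ?_)
    exact fun h0 => hk (Finset.sum_eq_zero_iff.1 h0 i (Finset.mem_univ i))
  | G g y ih =>
    refine congrArg (Str.G g) (funext fun i => ih i fun r k hk => h r k ?_)
    exact fun h0 => hk (Finset.sum_eq_zero_iff.1 h0 i (Finset.mem_univ i))

/-- Assignments to disjoint sets of metavariables have a common extension. -/
theorem exists_common_extension {ι : Type*} (occ : ι → OT → ℕ → Prop)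
    (hocc : ∀ r k i j, occ i r k → occ j r k → i = j) (η : ι → (s : OT) → ℕ → Str S Atom s) :
    ∃ η' : (s : OT) → ℕ → Str S Atom s, ∀ i r k, occ i r k → η' r k = η i r k := by
  classical
  -- The default `.fm .bot` is arbitrary; it serves only metavariables that occur nowhere.
  refine ⟨fun r k => if h : ∃ i, occ i r k then η h.choose r k else .fm .bot, fun i r k hi => ?_⟩
  have h : ∃ i, occ i r k := ⟨i, hi⟩
  exact (dif_pos h).trans (by rw [hocc r k _ _ h.choose_spec hi])

theorem eq_of_sum_le_one {n : ℕ} {c : Fin n → ℕ} (h : ∑ i, c i ≤ 1) {i j : Fin n}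
    (hi : c i ≠ 0) (hj : c j ≠ 0) : i = j := by
  by_contra hij
  have := Finset.add_le_sum (f := c) (s := Finset.univ) (fun _ _ => Nat.zero_le _)
    (Finset.mem_univ i) (Finset.mem_univ j) hij
  omega

namespace FunctionalFrame

variable {D : Calculus S} (𝔽 : FunctionalFrame Atom D)

/-- Every metavariable of `t` is assigned a point of the stable set that `h` assigns to it. -/
def Admissible (h : OT → ℕ → 𝔽.frame.Stable) (η : (s : OT) → ℕ → Str S Atom s) {s : OT}
    (t : MStr S s) : Prop :=
  ∀ r k, t.count r k ≠ 0 → r.le (𝔽.gen r (η r k)) (h r k)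

variable {𝔽} {h : OT → ℕ → 𝔽.frame.Stable}

/-- Since `gen` commutes with connectives, this is monotonicity. It needs no linearity, so it
applies to premises. -/
theorem Admissible.gen_inst_le {η : (s : OT) → ℕ → Str S Atom s} {s : OT} {t : MStr S s}
    (hη : 𝔽.Admissible h η t) : s.le (𝔽.gen s (t.inst η)) (𝔽.alg.evalMStr h t) := by
  have hres := 𝔽.isLEFrame.isResiduated.tense
  induction t with
  | var k => exact hη _ k (by simp [MStr.count])
  | F f x ih =>
    refine (𝔽.gen_F f _).le.trans (hres.f_mono f fun i => ih i fun r k hk => hη r k ?_)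
    exact fun h0 => hk (Finset.sum_eq_zero_iff.1 h0 i (Finset.mem_univ i))
  | G g y ih =>
    refine le_trans (hres.g_mono g fun i => ih i fun r k hk => hη r k ?_) (𝔽.gen_G g _).ge
    exact fun h0 => hk (Finset.sum_eq_zero_iff.1 h0 i (Finset.mem_univ i))

/-- Each argument can be tested on its generated instances, because residuation moves the rest of
the term into the bound; hence `c` is general in the induction. Linearity lets the assignments
chosen for different arguments be merged into one. -/
theorem evalMStr_le_of_forall_admissible {s : OT} {t : MStr S s} (ht : ∀ r k, t.count r k ≤ 1)
    {c : 𝔽.frame.Stable}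
    (hc : ∀ η, 𝔽.Admissible h η t → s.le (𝔽.gen s (t.inst η)) c) :
    s.le (𝔽.alg.evalMStr h t) c := by
  have hres := 𝔽.isLEFrame.isResiduated.tense
  induction t generalizing c with
  | @var s k =>
    refine FrameData.side_subset_side_iff.1 fun v hv => FrameData.mem_side_iff.2 ?_
    -- Only the value at `(s, k)` matters: it is the given point `v`.
    let η (r : OT) (_ : ℕ) : Str S Atom r :=
      if e : s = r then cast (congrArg (Str S Atom) e) v else .fm .bot
    have hv' : η s k = v := dif_pos rfl
    have hη := hc η fun r m hm => by
      obtain ⟨rfl, rfl⟩ : s = r ∧ k = m := by simpa [MStr.count] using hm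
      rw [hv']
      exact FrameData.mem_side_iff.1 hv
    rwa [MStr.inst, hv'] at hη
  | F f x ih =>
    refine forall_of_forall_update
      (fun i d => ∃ η, 𝔽.Admissible h η (x i) ∧ 𝔽.gen _ ((x i).inst η) = d)
      (fun i d => (S.star.epsF f i).le d (𝔽.alg.evalMStr h (x i)))
      (P := fun a => 𝔽.alg.tense.fOp f a ≤ c) (fun i a ha d hd => ?_) (fun a ha => ?_) _
      fun i => OT.le_refl _ _
    -- The residual `r` is the bound to which the induction hypothesis for argument `i` is applied.
    · obtain ⟨r, hr⟩ := hres.f f i a c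
      refine (hr d).2 (OT.le_trans _ hd (ih i (fun r k => ?_) fun η hη =>
        (hr _).1 (ha _ ⟨η, hη, rfl⟩)))
      exact (Finset.single_le_sum (f := fun i => (x i).count r k) (fun _ _ => Nat.zero_le _)
        (Finset.mem_univ i)).trans (ht r k)
    · choose η hη hηa using ha
      -- No metavariable occurs in two arguments, so the assignments `η i` do not conflict.
      obtain ⟨η', hη'⟩ := exists_common_extension (fun i r k => (x i).count r k ≠ 0)
        (fun r k i j hi hj => eq_of_sum_le_one (ht r k) hi hj) η
      have hx i : (x i).inst η' = (x i).inst (η i) := MStr.inst_congr _ (hη' i)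
      have := hc η' fun r k hk => by
        obtain ⟨i, -, hi⟩ := Finset.exists_ne_zero_of_sum_ne_zero hk
        rw [hη' i r k hi]
        exact hη i r k hi
      obtain rfl : (fun i => 𝔽.gen _ ((x i).inst η')) = a := funext fun i => by rw [hx, hηa]
      exact (𝔽.gen_F f _).ge.trans this
  | G g y ih =>
    refine forall_of_forall_update
      (fun i d => ∃ η, 𝔽.Admissible h η (y i) ∧ 𝔽.gen _ ((y i).inst η) = d)
      (fun i d => (S.star.epsG g i).op.le d (𝔽.alg.evalMStr h (y i)))
      (P := fun a => c ≤ 𝔽.alg.tense.gOp g a) (fun i a ha d hd => ?_) (fun a ha => ?_) _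
      fun i => OT.le_refl _ _
    · obtain ⟨r, hr⟩ := hres.g g i a c
      refine (hr d).2 (OT.le_trans _ hd (ih i (fun r k => ?_) fun η hη =>
        (hr _).1 (ha _ ⟨η, hη, rfl⟩)))
      exact (Finset.single_le_sum (f := fun i => (y i).count r k) (fun _ _ => Nat.zero_le _)
        (Finset.mem_univ i)).trans (ht r k)
    · choose η hη hηa using ha
      obtain ⟨η', hη'⟩ := exists_common_extension (fun i r k => (y i).count r k ≠ 0)
        (fun r k i j hi hj => eq_of_sum_le_one (ht r k) hi hj) η
      have hy i : (y i).inst η' = (y i).inst (η i) := MStr.inst_congr _ (hη' i)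
      have := hc η' fun r k hk => by
        obtain ⟨i, -, hi⟩ := Finset.exists_ne_zero_of_sum_ne_zero hk
        rw [hη' i r k hi]
        exact hη i r k hi
      obtain rfl : (fun i => 𝔽.gen _ ((y i).inst η')) = a := funext fun i => by rw [hy, hηa]
      exact le_trans this (𝔽.gen_G g _).le

/-- Both sides of the conclusion reduce to generators. Condition `c3` merges the two assignments,
and `c1` makes the merged assignment admissible for every premise. -/
theorem soundRule {R : StructRule S} (hR : R ∈ D.extra) : 𝔽.alg.SoundRule R := by
  intro h hprem
  have hRa := D.analytic R hR
  refine evalMStr_le_of_forall_admissible (s := .one)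
    (fun r k => le_trans (Nat.le_add_right _ _) (hRa.c3 r k)) fun η₁ h₁ => ?_
  refine evalMStr_le_of_forall_admissible (s := .dual)
    (fun r k => le_trans (Nat.le_add_left _ _) (hRa.c3 r k)) fun η₂ h₂ => ?_
  -- The index `Bool` distinguishes the two sides of the conclusion, `true` being the antecedent.
  obtain ⟨η, hη⟩ := exists_common_extension
    (fun b : Bool => fun r k => (bif b then R.concl.ant.count r k else R.concl.suc.count r k) ≠ 0)
    (fun r k i j hi hj => by
      have := hRa.c3 r k
      unfold MSqt.count at this
      cases i <;> cases j <;> simp_all <;> omega)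
    (fun b => bif b then η₁ else η₂)
  have e₁ : R.concl.ant.inst η = R.concl.ant.inst η₁ := MStr.inst_congr _ (hη true)
  have e₂ : R.concl.suc.inst η = R.concl.suc.inst η₂ := MStr.inst_congr _ (hη false)
  have hadm : ∀ r k, R.concl.count r k ≠ 0 → r.le (𝔽.gen r (η r k)) (h r k) := by
    intro r k hk
    by_cases hk₁ : R.concl.ant.count r k = 0
    · have hk₂ : R.concl.suc.count r k ≠ 0 := fun h0 => hk (by simp [MSqt.count, hk₁, h0])
      rw [hη false r k hk₂]
      exact h₂ r k hk₂
    · rw [hη true r k hk₁]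
      exact h₁ r k hk₁
  rw [← e₁, ← e₂]
  refine 𝔽.gen_le_gen.2 (𝔽.closed _ (R.concl.inst η) (.inr (.inr ⟨R, hR, η, rfl, rfl⟩)) ?_)
  simp only [List.forall_mem_map]
  intro a ha
  have hant : 𝔽.Admissible h η a.ant := fun r k hk =>
    hadm r k (hRa.c1 a ha r k fun h0 => hk (Nat.add_eq_zero_iff.1 h0).1)
  have hsuc : 𝔽.Admissible h η a.suc := fun r k hk =>
    hadm r k (hRa.c1 a ha r k fun h0 => hk (Nat.add_eq_zero_iff.1 h0).2)
  -- The generated sets enclose the premise: `gen` of the antecedent instance is below its value,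
  -- and the value of the succedent is below `gen` of its instance.
  exact 𝔽.gen_le_gen.1 (hant.gen_inst_le.trans ((hprem a ha).trans hsuc.gen_inst_le))

end FunctionalFrame

end LEDisplay

theorem mainTheorem3 (S : Sig.{u}) (Atom : Type u) (D : Calculus S)
    (𝔽 : FunctionalFrame Atom D) :
    ∃ h𝔽 : 𝔽.frame.IsLEFrame,
      -- every rule of `D` is sound in the complex algebra
      (∀ (prems : List (Sqt S Atom)) (concl : Sqt S Atom), D.IsRule prems concl →
        (𝔽.frame.complexAlg h𝔽).SoundInstance prems concl) ∧
      (∀ R ∈ D.extra, (𝔽.frame.complexAlg h𝔽).SoundRule R) ∧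
      -- the complex algebra is a complete `L`-algebra, and hence a complete `L*`-algebra
      (𝔽.frame.complexAlg h𝔽).IsNormal ∧
      (𝔽.frame.complexAlg h𝔽).IsComplete ∧
      (𝔽.frame.complexAlg h𝔽).tense.IsTense ∧
      -- it validates the logic of the additional rules: every sequent of formulas derivable from
      -- them, and every axiomatic extension of the minimal logic that corresponds to them
      (∀ φ ψ : Fm S Atom, D.withCut.Derivable ⟨.fm φ, .fm ψ⟩ →
        (𝔽.frame.complexAlg h𝔽).Valid φ ψ) ∧
      (∀ Ax : Set (Fm S Atom × Fm S Atom), Corresponds D.extra Ax →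
        ∀ φ ψ : Fm S Atom, Logic Ax φ ψ → (𝔽.frame.complexAlg h𝔽).Valid φ ψ) := by
  have hres := 𝔽.isLEFrame.isResiduated
  have hD : ∀ R ∈ D.extra, 𝔽.alg.SoundRule R := fun R hR => FunctionalFrame.soundRule hR
  exact ⟨𝔽.isLEFrame, fun _ _ h => hres.soundInstance hD h, hD, hres.isComplete.isNormal,
    hres.isComplete, hres.isTense,
    -- Adding cut leaves the set of structural rules unchanged, so `hD` still applies, even if `N`
    -- is closed only under cut-free rules.
    fun φ ψ h V => hres.sat_of_derivable (D := D.withCut) hD V h,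
    fun Ax hAx φ ψ h => hres.valid_of_logic ((hAx _ _ hres.isComplete).1 hD) h⟩
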